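/- **Problem.** Let $g:\mathbb R^n\to\mathbb R$ and $c=(c_1,\dots,c_l):\mathbb R^n\to\mathbb R^l$ be differentiable and let $h$ be a closed convex extended-valued function with compact effective domain $X=\operatorname{dom}(h)$. Consider $\min_x\{f_0(x)=g(x)+h(x)\ :\ c(x)=0\}$. Norms are Euclidean, $J_c$ is the Jacobian of $c$, $\partial h$ is the convex subdifferential, $\partial f_0=\nabla g+\partial h$, and $\operatorname{dist}(u,\emptyset)=+\infty$. A point $x$ is an $\varepsilon$-KKT point if $\|c(x)\|\le\varepsilon$ and $\operatorname{dist}(0,\partial f_0(x)+J_c(x)^\top y)\le\varepsilon$ for some $y\in\mathbb R^l$. **Assumptions.** There are constants $L_0,\rho_0,L_j,\rho_j\ge 0$ such that $\nabla g$ is $L_0$-Lipschitz on $\mathbb R^n$, $g+\frac{\rho_0}{2}\|\cdot\|^2$ is convex, and for each $j$, $\nabla c_j$ is $L_j$-Lipschitz on $\mathbb R^n$ and both $c_j+\frac{\rho_j}{2}\|\cdot\|^2$ and $-c_j+\frac{\rho_j}{2}\|\cdot\|^2$ are convex (for example $\rho_j=L_j$). Let $B_j$ be an upper bound for $|c_j|$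 and $\|\nabla c_j\|$ on the compact convex set $\{2x-x':x,x'\in X\}\supseteq X$. Put $$\rho_c=\sum_jB_j\rho_j,\quad L_c=\sum_j(B_jL_j+B_j^2),\quad \bar L=\Big(\sum_jL_j^2\Big)^{1/2},$$ and assume $\rho_0+\rho_c>0$. **Algorithm APG**$(G,h,\mu,L,\varepsilon)$. Choose $\bar x^{-1}\in X$, put $\alpha=\sqrt{\mu/L}$ and $\bar x^0=x^0=\arg\min_x\langle\nabla G(\bar x^{-1}),x\rangle+\frac L2\|x-\bar x^{-1}\|^2+h(x)$. Iteration $t=0,1,\dots$: set $x^{t+1}=\arg\min_x\langle\nabla G(\bar x^t),x\rangle+\frac L2\|x-\bar x^t\|^2+h(x)$ and $\bar x^{t+1}=x^{t+1}+\frac{1-\alpha}{1+\alpha}(x^{t+1}-x^t)$; if $\operatorname{dist}(-\nabla G(x^{t+1}),\partial h(x^{t+1}))\le\varepsilon$, output $x^{t+1}$ and stop. **Algorithm iPPM**$(\phi,h,x^0,\rho,L,\varepsilon)$. For $t=0,1,\dots$: let $x^{t+1}$ be the output of APG$(\phi+\rho\|\cdot-x^t\|^2,h,\rho,L+2\rho,\varepsilon/4)$;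 if $2\rho\|x^{t+1}-x^t\|\le\varepsilon/2$, return $x^{t+1}$. **Algorithm iALM.** Fix $x^0\in X$, $y^0=0$, $\beta_0>0$, $\sigma>1$, $w_0>0$, and put $\beta_k=\beta_0\sigma^k$ and $\gamma_k=\frac{(\log2)^2\|c(x^0)\|}{(k+1)[\log(k+2)]^2}$. For $k=0,1,\dots$: let $\hat\rho_k=\rho_0+\bar L\|y^k\|+\beta_k\rho_c$, $\hat L_k=L_0+\bar L\|y^k\|+\beta_kL_c$, $\phi_k=g+\langle y^k,c(\cdot)\rangle+\frac{\beta_k}2\|c(\cdot)\|^2$; let $x^{k+1}$ be the output of iPPM$(\phi_k,h,x^k,\hat\rho_k,\hat L_k,\varepsilon)$, and let $y^{k+1}=y^k+w_kc(x^{k+1})$ with $w_k=w_0\min\{1,\gamma_k/\|c(x^{k+1})\|\}$ (the value of $w_k$ is immaterial if $c(x^{k+1})=0$). **Theorem.** Let $v>0$. There are $C>0$ and $p\in\mathbb N$, independent of $\varepsilon$ and of the starting points of the APG calls, such that the following holds for every $0<\varepsilon\le1$ and every choice of the APG starting points in $X$. If the regularity condition $$v\|c(x^k)\|\le\operatorname{dist}\big(-J_c(x^k)^\top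 c(x^k),\ \partial h(x^k)/\beta_{k-1}\big)\qquad(k\ge1)$$ holds along the run of iALM with tolerance $\varepsilon$, then for some $K\ge1$ all APG and iPPM calls in the first $K$ outer iterations terminate, $x^K$ is an $\varepsilon$-KKT point, and the total number of APG iterations used to compute $x^K$ is at most $C\varepsilon^{-3}(1+\log\frac1\varepsilon)^p$, i.e. $\tilde O(\varepsilon^{-3})$. If moreover $c(x)=Ax-b$ and $\rho_j=0$ for all $j$, the same holds (with possibly other $C,p$) with the bound $C\varepsilon^{-5/2}(1+\log\frac1\varepsilon)^p$, i.e. $\tilde O(\varepsilon^{-5/2})$. -/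

import Mathlib

noncomputable section

namespace IALM

open scoped InnerProductSpace

/-- Euclidean space `ℝⁿ` with its Euclidean norm. -/
abbrev Vec (n : ℕ) := EuclideanSpace ℝ (Fin n)

section Basic

variable {n : ℕ}

/-- `f` is differentiable on `ℝⁿ` and its gradient is `L`-Lipschitz. -/
def IsSmoothWith (L : ℝ) (f : Vec n → ℝ) : Prop :=
  Differentiable ℝ f ∧ ∀ x y, ‖gradient f x - gradient f y‖ ≤ L * ‖x - y‖

/-- `f + (ρ/2)‖·‖²` is convex on `ℝⁿ`. -/
def IsWeaklyConvex (ρ : ℝ) (f : Vec n → ℝ) : Prop :=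
  ConvexOn ℝ Set.univ fun x => f x + ρ / 2 * ‖x‖ ^ 2

/-- Convex subdifferential at `x` of the extended-valued function that is `h` on its effective
domain `X` and `+∞` off `X`; it is empty for `x ∉ X`. -/
def subdiff (X : Set (Vec n)) (h : Vec n → ℝ) (x : Vec n) : Set (Vec n) :=
  {s | x ∈ X ∧ ∀ z ∈ X, h x + ⟪s, z - x⟫_ℝ ≤ h z}

/-- The minimizer over `z ∈ X` of `⟨ξ, z⟩ + (L/2)‖z - u‖² + h z`
(unique for `L > 0`, `X` compact nonempty, `h` convex and lower semicontinuous on `X`). -/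
def proxStep (X : Set (Vec n)) (h : Vec n → ℝ) (L : ℝ) (ξ u : Vec n) : Vec n :=
  Classical.epsilon fun z => z ∈ X ∧
    IsMinOn (fun z' => ⟪ξ, z'⟫_ℝ + L / 2 * ‖z' - u‖ ^ 2 + h z') X z

end Basic

section APG

/-! Accelerated proximal gradient method for `G + h`, with strong convexity parameter `μ`, smoothness
parameter `L`, initial point `u`, and tolerance `ε`. -/

variable {n : ℕ} (X : Set (Vec n)) (h G : Vec n → ℝ) (μ L : ℝ) (u : Vec n)

/-- The pair `(xᵗ, x̄ᵗ)` of iterate and extrapolated point, `α = √(μ/L)`. -/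
def apgState : ℕ → Vec n × Vec n
  | 0 => (proxStep X h L (gradient G u) u, proxStep X h L (gradient G u) u)
  | t + 1 =>
    let x := (apgState t).1
    let xbar := (apgState t).2
    let α := Real.sqrt (μ / L)
    let x' := proxStep X h L (gradient G xbar) xbar
    (x', x' + ((1 - α) / (1 + α)) • (x' - x))

/-- The iterations `t ≥ 1` after which the stopping test
`dist(-∇G(xᵗ), ∂h(xᵗ)) ≤ ε` is satisfied. -/
def apgStopSet (ε : ℝ) : Set ℕ :=
  {t | 1 ≤ t ∧ Metric.infEDist (-gradient G (apgState X h G μ L u t).1)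
    (subdiff X h (apgState X h G μ L u t).1) ≤ ENNReal.ofReal ε}

/-- The number of iterations until APG stops (meaningful when the stop set is nonempty). -/
def apgIters (ε : ℝ) : ℕ := sInf (apgStopSet X h G μ L u ε)

/-- The output of APG. -/
def apgOut (ε : ℝ) : Vec n := (apgState X h G μ L u (apgIters X h G μ L u ε)).1

end APG

section IPPM

/-! Inexact proximal point method for `φ + h` started at `x₀`, with parameters `ρ`, `L` and
tolerance `ε`; the `t`-th call of APG is started at `init t`. -/

variable {n : ℕ} (X : Set (Vec n)) (h φ : Vec n → ℝ) (x₀ : Vec n) (ρ L ε : ℝ) (init : ℕ → Vec n)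

/-- The smooth part of the proximal subproblem with center `p`. -/
def ippmModel (p : Vec n) : Vec n → ℝ := fun z => φ z + ρ * ‖z - p‖ ^ 2

/-- The iterates of iPPM, disregarding its stopping test. -/
def ippmIter : ℕ → Vec n
  | 0 => x₀
  | t + 1 => apgOut X h (ippmModel φ ρ (ippmIter t)) ρ (L + 2 * ρ) (init t) (ε / 4)

/-- The stop set of the `t`-th APG call of iPPM. -/
def ippmApgStopSet (t : ℕ) : Set ℕ :=
  apgStopSet X h (ippmModel φ ρ (ippmIter X h φ x₀ ρ L ε init t)) ρ (L + 2 * ρ) (init t) (ε / 4)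

/-- The number of APG iterations in the `t`-th APG call of iPPM. -/
def ippmApgIters (t : ℕ) : ℕ :=
  apgIters X h (ippmModel φ ρ (ippmIter X h φ x₀ ρ L ε init t)) ρ (L + 2 * ρ) (init t) (ε / 4)

/-- The numbers `s = t + 1 ≥ 1` of iterations after which the test `2ρ‖xᵗ⁺¹ - xᵗ‖ ≤ ε/2` of iPPM
is satisfied. -/
def ippmStopSet : Set ℕ :=
  {s | ∃ t, s = t + 1 ∧ 2 * ρ *
    ‖ippmIter X h φ x₀ ρ L ε init (t + 1) - ippmIter X h φ x₀ ρ L ε init t‖ ≤ ε / 2}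

/-- The number of iterations until iPPM stops (meaningful when the stop set is nonempty). -/
def ippmIters : ℕ := sInf (ippmStopSet X h φ x₀ ρ L ε init)

/-- The output of iPPM. -/
def ippmOut : Vec n := ippmIter X h φ x₀ ρ L ε init (ippmIters X h φ x₀ ρ L ε init)

/-- iPPM stops, and so does each of the APG calls it makes before. -/
def ippmTerminates : Prop :=
  (ippmStopSet X h φ x₀ ρ L ε init).Nonempty ∧
    ∀ t < ippmIters X h φ x₀ ρ L ε init, (ippmApgStopSet X h φ x₀ ρ L ε init t).Nonempty

/-- The total number of APG iterations made by iPPM. -/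
def ippmCost : ℕ :=
  ∑ t ∈ Finset.range (ippmIters X h φ x₀ ρ L ε init), ippmApgIters X h φ x₀ ρ L ε init t

end IPPM

/-- The data of the problem `min g(x) + h(x)` subject to `c(x) = 0`, and the inputs of iALM.
The extended-valued function `h` is given by its effective domain `X = dom h` and its (real) values
there; values of `h` off `X` are never used. -/
structure Setup (n l : ℕ) where
  X : Set (Vec n)
  h : Vec n → ℝ
  g : Vec n → ℝ
  c : Vec n → Vec l
  /-- smoothness constant of `g` -/
  L₀ : ℝ
  /-- weak convexity constant of `g` -/
  ρ₀ : ℝ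
  /-- smoothness constants of the components of `c` -/
  L : Fin l → ℝ
  /-- weak convexity constants of the components of `c` -/
  ρ : Fin l → ℝ
  /-- bounds for the components of `c` and for their gradients -/
  B : Fin l → ℝ
  /-- initial point -/
  x₀ : Vec n
  /-- initial penalty parameter -/
  β₀ : ℝ
  /-- growth factor of the penalty parameter -/
  σ : ℝ
  /-- dual step size factor -/
  w₀ : ℝ

namespace Setup

variable {n l : ℕ} (P : Setup n l)

/-- The gradient of the `j`-th component of `c`. -/
def gradC (j : Fin l) (x : Vec n) : Vec n := gradient (𝕜 := ℝ) (fun z => P.c z j) x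

/-- `J_c(x)ᵀ y`. -/
def jacT (x : Vec n) (y : Vec l) : Vec n := ∑ j, y j • P.gradC j x

/-- The standing assumptions on the problem and on the inputs of the algorithm (the regularity
condition is `Regular` below). -/
structure Admissible : Prop where
  L₀_nonneg : 0 ≤ P.L₀
  ρ₀_nonneg : 0 ≤ P.ρ₀
  L_nonneg : ∀ j, 0 ≤ P.L j
  ρ_nonneg : ∀ j, 0 ≤ P.ρ j
  g_smooth : IsSmoothWith P.L₀ P.g
  g_weak : IsWeaklyConvex P.ρ₀ P.g
  c_smooth : ∀ j, IsSmoothWith (P.L j) fun x => P.c x j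
  c_weak : ∀ j, IsWeaklyConvex (P.ρ j) fun x => P.c x j
  neg_c_weak : ∀ j, IsWeaklyConvex (P.ρ j) fun x => -P.c x j
  X_compact : IsCompact P.X
  h_convex : ConvexOn ℝ P.X P.h
  h_closed : LowerSemicontinuousOn P.h P.X
  /-- `B j` bounds `|c_j|` and `‖∇c_j‖` on `{2x - x' : x, x' ∈ dom h}`, a convex set that contains
  `dom h` and every extrapolation `x + θ(x - x')`, `0 ≤ θ ≤ 1`. -/
  B_bound : ∀ j, ∀ x ∈ P.X, ∀ x' ∈ P.X,
    |P.c ((2 : ℝ) • x - x') j| ≤ P.B j ∧ ‖P.gradC j ((2 : ℝ) • x - x')‖ ≤ P.B j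
  x₀_mem : P.x₀ ∈ P.X
  β₀_pos : 0 < P.β₀
  one_lt_σ : 1 < P.σ
  w₀_pos : 0 < P.w₀
  /-- `ρ₀ + ρ_c > 0`, so that the parameters `ρ̂_k` are positive. -/
  ρ_pos : 0 < P.ρ₀ + ∑ j, P.B j * P.ρ j

/-- `ρ_c = ∑ B_j ρ_j`. -/
def ρc : ℝ := ∑ j, P.B j * P.ρ j

/-- `L_c = ∑ (B_j L_j + B_j²)`. -/
def Lc : ℝ := ∑ j, (P.B j * P.L j + P.B j ^ 2)

/-- `L̄ = √(∑ L_j²)`. -/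
def Lbar : ℝ := Real.sqrt (∑ j, P.L j ^ 2)

/-- `β_k = β₀ σᵏ`. -/
def β (k : ℕ) : ℝ := P.β₀ * P.σ ^ k

/-- `γ_k = (log 2)² ‖c(x⁰)‖ / ((k+1) (log (k+2))²)`. -/
def γ (k : ℕ) : ℝ :=
  Real.log 2 ^ 2 * ‖P.c P.x₀‖ / ((k + 1) * Real.log (k + 2) ^ 2)

/-- The augmented Lagrangian without its nonsmooth part:
`L_b(x, y) - h(x) = g(x) + ⟨y, c(x)⟩ + (b/2)‖c(x)‖²`. -/
def augLag (b : ℝ) (y : Vec l) : Vec n → ℝ :=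
  fun x => P.g x + ⟪y, P.c x⟫_ℝ + b / 2 * ‖P.c x‖ ^ 2

/-- `ρ̂_k` for the multiplier `y`. -/
def ρhat (k : ℕ) (y : Vec l) : ℝ := P.ρ₀ + P.Lbar * ‖y‖ + P.β k * P.ρc

/-- `L̂_k` for the multiplier `y`. -/
def Lhat (k : ℕ) (y : Vec l) : ℝ := P.L₀ + P.Lbar * ‖y‖ + P.β k * P.Lc

/-- The dual step size `w_k` for the new primal iterate `x`. -/
def dualStep (k : ℕ) (x : Vec n) : ℝ := P.w₀ * min 1 (P.γ k / ‖P.c x‖)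

/-- `∂f₀(x) = ∇g(x) + ∂h(x)` for `f₀ = g + h`. -/
def subdiffObj (x : Vec n) : Set (Vec n) := (fun s => gradient P.g x + s) '' subdiff P.X P.h x

/-- `x` is an `ε`-KKT point: for some `y`, `‖c(x)‖ ≤ ε` and
`dist(0, ∂f₀(x) + J_c(x)ᵀ y) ≤ ε`. -/
def IsKKT (ε : ℝ) (x : Vec n) : Prop :=
  ∃ y : Vec l, ‖P.c x‖ ≤ ε ∧
    Metric.infEDist 0 ((fun s => s + P.jacT x y) '' P.subdiffObj x) ≤ ENNReal.ofReal ε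

section Run

/-! A run of iALM with tolerance `ε`; the starting point of the `t`-th APG call within outer
iteration `k` is `init k t`. -/

variable (ε : ℝ) (init : ℕ → ℕ → Vec n)

/-- The pair `(xᵏ, yᵏ)`. -/
def state : ℕ → Vec n × Vec l
  | 0 => (P.x₀, 0)
  | k + 1 =>
    let x := (state k).1
    let y := (state k).2
    let x' := ippmOut P.X P.h (P.augLag (P.β k) y) x (P.ρhat k y) (P.Lhat k y) ε (init k)
    (x', y + P.dualStep k x' • P.c x')

/-- All calls of iPPM and of APG in outer iteration `k` terminate. -/
def Terminates (k : ℕ) : Prop :=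
  let x := (P.state ε init k).1
  let y := (P.state ε init k).2
  ippmTerminates P.X P.h (P.augLag (P.β k) y) x (P.ρhat k y) (P.Lhat k y) ε (init k)

/-- The number of APG iterations in outer iteration `k`. -/
def cost (k : ℕ) : ℕ :=
  let x := (P.state ε init k).1
  let y := (P.state ε init k).2
  ippmCost P.X P.h (P.augLag (P.β k) y) x (P.ρhat k y) (P.Lhat k y) ε (init k)

/-- The regularity condition with constant `v` along the run:
`v ‖c(xᵏ)‖ ≤ dist(-J_c(xᵏ)ᵀ c(xᵏ), ∂h(xᵏ) / β_{k-1})` for all `k ≥ 1`. -/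
def Regular (v : ℝ) : Prop :=
  ∀ k : ℕ,
    let x := (P.state ε init (k + 1)).1
    ENNReal.ofReal (v * ‖P.c x‖) ≤
      Metric.infEDist (-P.jacT x (P.c x)) ((fun s => (P.β k)⁻¹ • s) '' subdiff P.X P.h x)

/-- The run produces an `ε`-KKT point `xᴷ`, `K ≥ 1`, within `N` APG iterations in total. -/
def ReachesKKTWithin (N : ℝ) : Prop :=
  ∃ K : ℕ, 1 ≤ K ∧ (∀ k < K, P.Terminates ε init k) ∧
    P.IsKKT ε (P.state ε init K).1 ∧
    ((∑ k ∈ Finset.range K, P.cost ε init k : ℕ) : ℝ) ≤ N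

end Run

end Setup

end IALM

end

/-! Each outer iteration finds an approximately stationary point of the augmented Lagrangian plus
`h`. Dividing the stationarity residual by `β_k` puts a point of `∂h / β_k` within O((1 +
‖y^k‖)/β_k) of `-J_cᵀ c`, so regularity gives ‖c(x^{k+1})‖ = O((1 + ‖y^k‖)/β_k) (`norm_c_state_le`).
The dual steps are capped, so ‖y^k‖ grows at most linearly in k. Fed back into the estimate, this
makes the dual increments O((1 + k)/β_k), which is summable because `β_k` is geometric: the
multipliers are bounded (`exists_dual_bound`). Hence ‖c(x^{k+1})‖ ≤ M/β_k, and the first k with β_k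
≥ M/ε, reached after O(1 + log(1/ε)) outer steps, gives an ε-KKT point with multiplier y^k + β_k
c(x^{k+1}).

For the cost of one outer step, the bound on c also bounds the objective gap Δ of the warm start
uniformly in k (`exists_run_bounds`). Proximal steps that fail the stopping test each decrease the
objective by ε²/(64ρ), so iPPM makes O(ρΔ/ε² + 1) of them. Every APG call converges linearly at rate
1 - √(μ/L) and takes √((L + 2ρ)/ρ) iterations up to logarithms. The product is of order √(ρL)/ε².
With L = O(1/ε) and ρ = O(ε^{-e}) this is ε^{-(5+e)/2}; e = 1 holds in general, and e = 0 when ρ_c =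
0, since then ρ̂_k does not grow with β_k. -/

namespace IALM

open scoped InnerProductSpace

/-! ### First-order bounds for smooth and for weakly convex functions. -/

section FirstOrder

variable {n : ℕ}

theorem norm_sq_convexCombo (a b : Vec n) (t : ℝ) :
    ‖(1 - t) • a + t • b‖ ^ 2 = (1 - t) * ‖a‖ ^ 2 + t * ‖b‖ ^ 2 - t * (1 - t) * ‖a - b‖ ^ 2 := by
  rw [norm_add_sq_real, norm_sub_sq_real, norm_smul, norm_smul, mul_pow, mul_pow,
    Real.norm_eq_abs, Real.norm_eq_abs, sq_abs, sq_abs, real_inner_smul_left,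
    real_inner_smul_right]
  ring

theorem hasDerivAt_line {f : Vec n → ℝ} (hf : Differentiable ℝ f) (x d : Vec n) (t : ℝ) :
    HasDerivAt (fun s : ℝ => f (x + s • d)) ⟪gradient f (x + t • d), d⟫_ℝ t := by
  have h1 : HasDerivAt (fun s : ℝ => x + s • d) d t := by
    simpa using ((hasDerivAt_id t).smul_const d).const_add x
  have h2 := (hf (x + t • d)).hasGradientAt.hasFDerivAt
  have h3 := h2.comp_hasDerivAt t h1
  rw [InnerProductSpace.toDual_apply_apply] at h3
  exact h3

theorem IsSmoothWith.abs_sub_linear_le {L : ℝ} {f : Vec n → ℝ} (hf : IsSmoothWith L f)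
    (x z : Vec n) :
    |f z - f x - ⟪gradient f x, z - x⟫_ℝ| ≤ L / 2 * ‖z - x‖ ^ 2 := by
  set d := z - x with hd
  have hder : ∀ t : ℝ, HasDerivAt (fun s : ℝ => f (x + s • d) - f x - s * ⟪gradient f x, d⟫_ℝ)
      (⟪gradient f (x + t • d), d⟫_ℝ - ⟪gradient f x, d⟫_ℝ) t := by
    intro t
    have h2 := (hasDerivAt_id t).mul_const ⟪gradient f x, d⟫_ℝ
    have h3 := ((hasDerivAt_line hf.1 x d t).sub_const (f x)).sub h2
    rw [one_mul] at h3
    exact h3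
  have hB : ∀ t : ℝ, HasDerivAt (fun s : ℝ => L / 2 * ‖d‖ ^ 2 * s ^ 2) (L * ‖d‖ ^ 2 * t) t := by
    intro t
    have := (hasDerivAt_pow 2 t).const_mul (L / 2 * ‖d‖ ^ 2)
    exact this.congr_deriv (by norm_num; ring)
  -- On the segment the derivative of the linearization error is at most L‖d‖²t, which integrates to
  -- L/2 ‖d‖² on [0, 1].
  have key := image_norm_le_of_norm_deriv_right_le_deriv_boundary (a := (0 : ℝ)) (b := 1)
    (f := fun s : ℝ => f (x + s • d) - f x - s * ⟪gradient f x, d⟫_ℝ)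
    (f' := fun t => ⟪gradient f (x + t • d), d⟫_ℝ - ⟪gradient f x, d⟫_ℝ)
    (B := fun s : ℝ => L / 2 * ‖d‖ ^ 2 * s ^ 2) (B' := fun t => L * ‖d‖ ^ 2 * t)
    (fun t _ => (hder t).continuousAt.continuousWithinAt)
    (fun t _ => (hder t).hasDerivWithinAt) (by simp) hB ?_
    (x := 1) (by simp)
  · simpa [hd] using key
  · intro t ht
    rw [← inner_sub_left, Real.norm_eq_abs]
    refine (abs_real_inner_le_norm _ _).trans ?_
    have h1 := hf.2 (x + t • d) x
    rw [add_sub_cancel_left, norm_smul, Real.norm_eq_abs, abs_of_nonneg ht.1] at h1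
    nlinarith [norm_nonneg d]

/-- This is the tangent inequality of the convex function f + (ρ/2)‖·‖² restricted to the line
through x and z; expanding ‖z‖² around x leaves exactly the quadratic defect. -/
theorem IsWeaklyConvex.le_of_differentiable {ρ : ℝ} {f : Vec n → ℝ} (hf : IsWeaklyConvex ρ f)
    (hd : Differentiable ℝ f) (x z : Vec n) :
    f x + ⟪gradient f x, z - x⟫_ℝ - ρ / 2 * ‖z - x‖ ^ 2 ≤ f z := by
  set d := z - x with hdd
  have hc : ConvexOn ℝ Set.univ
      (fun s : ℝ => f (x + s • d) + ρ / 2 * ‖x + s • d‖ ^ 2) := by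
    refine ⟨convex_univ, fun a _ b _ p q hp hq hpq => ?_⟩
    have := hf.2 (Set.mem_univ (x + a • d)) (Set.mem_univ (x + b • d)) hp hq hpq
    have e : p • (x + a • d) + q • (x + b • d) = x + (p • a + q • b) • d := by
      have : x = (p + q) • x := by rw [hpq, one_smul]
      nth_rewrite 3 [this]
      simp only [smul_eq_mul]
      module
    rw [e] at this
    exact this
  have hq : HasDerivAt (fun s : ℝ => ρ / 2 * ‖x + s • d‖ ^ 2) (ρ * ⟪x, d⟫_ℝ) 0 := by
    have h1 : HasDerivAt (fun s : ℝ => x + s • d) d 0 := by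
      simpa using ((hasDerivAt_id (0 : ℝ)).smul_const d).const_add x
    have := (h1.norm_sq).const_mul (ρ / 2)
    exact this.congr_deriv (by rw [zero_smul, add_zero]; ring)
  have hs := hc.le_slope_of_hasDerivAt (Set.mem_univ 0) (Set.mem_univ 1) one_pos
    ((hasDerivAt_line hd x d 0).add hq)
  rw [slope_def_field] at hs
  have hz : x + d = z := by simp [hdd]
  simp only [zero_smul, add_zero, one_smul, hz, sub_zero, div_one] at hs
  have hn : ‖z‖ ^ 2 = ‖x‖ ^ 2 + 2 * ⟪x, d⟫_ℝ + ‖d‖ ^ 2 := by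
    rw [← hz, norm_add_sq_real]
  rw [hn] at hs
  linarith

end FirstOrder

/-! ### The proximal step and its optimality condition. -/

section Prox

variable {n : ℕ} {X : Set (Vec n)} {h : Vec n → ℝ}

theorem proxStep_spec (hX : IsCompact X) (hne : X.Nonempty) (hlsc : LowerSemicontinuousOn h X)
    (L : ℝ) (ξ u : Vec n) :
    proxStep X h L ξ u ∈ X ∧
      IsMinOn (fun z' => ⟪ξ, z'⟫_ℝ + L / 2 * ‖z' - u‖ ^ 2 + h z') X (proxStep X h L ξ u) := by
  refine Classical.epsilon_spec (p := fun z => z ∈ X ∧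
    IsMinOn (fun z' => ⟪ξ, z'⟫_ℝ + L / 2 * ‖z' - u‖ ^ 2 + h z') X z) ?_
  refine LowerSemicontinuousOn.exists_isMinOn hne hX (LowerSemicontinuousOn.add ?_ hlsc)
  apply ContinuousOn.lowerSemicontinuousOn
  fun_prop

/-- The three-point inequality for a proximal step. -/
theorem proxStep_three_point (hX : IsCompact X) (hh : ConvexOn ℝ X h)
    (hlsc : LowerSemicontinuousOn h X) (L : ℝ) (ξ u : Vec n) {z : Vec n} (hz : z ∈ X) :
    ⟪ξ, proxStep X h L ξ u⟫_ℝ + L / 2 * ‖proxStep X h L ξ u - u‖ ^ 2 + h (proxStep X h L ξ u)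
      + L / 2 * ‖z - proxStep X h L ξ u‖ ^ 2 ≤ ⟪ξ, z⟫_ℝ + L / 2 * ‖z - u‖ ^ 2 + h z := by
  obtain ⟨hp, hmin⟩ := proxStep_spec hX ⟨z, hz⟩ hlsc L ξ u
  set p := proxStep X h L ξ u
  set q : Vec n → ℝ := fun z' => ⟪ξ, z'⟫_ℝ + L / 2 * ‖z' - u‖ ^ 2 + h z' with hq
  -- Minimality is tested against points of the segment from p to z and divided by t; letting t → 0
  -- then recovers the full strong convexity term.
  have h1 : ∀ t : ℝ, 0 < t → t < 1 → q p + L / 2 * (1 - t) * ‖z - p‖ ^ 2 ≤ q z := by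
    intro t ht0 ht1
    have hw : (1 - t) • p + t • z ∈ X := hh.1 hp hz (by linarith) ht0.le (by ring)
    have hm : q p ≤ q ((1 - t) • p + t • z) := hmin hw
    have hc := hh.2 hp hz (show 0 ≤ 1 - t by linarith) ht0.le (by ring)
    simp only [smul_eq_mul] at hc
    have e : (1 - t) • p + t • z - u = (1 - t) • (p - u) + t • (z - u) := by module
    have hn := norm_sq_convexCombo (p - u) (z - u) t
    rw [← e, sub_sub_sub_cancel_right, norm_sub_rev p z] at hn
    have hqw : q ((1 - t) • p + t • z) ≤ (1 - t) * q p + t * q z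
        - L / 2 * (t * (1 - t)) * ‖z - p‖ ^ 2 := by
      simp only [hq]
      rw [hn, inner_add_right, real_inner_smul_right, real_inner_smul_right]
      linarith
    have : t * (q p + L / 2 * (1 - t) * ‖z - p‖ ^ 2) ≤ t * q z := by linarith
    exact le_of_mul_le_mul_left this ht0
  have hlim : Filter.Tendsto (fun t : ℝ => q p + L / 2 * (1 - t) * ‖z - p‖ ^ 2)
      (nhdsWithin 0 (Set.Ioi 0)) (nhds (q p + L / 2 * (1 - 0) * ‖z - p‖ ^ 2)) := by
    apply Filter.Tendsto.mono_left _ nhdsWithin_le_nhds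
    apply Continuous.tendsto
    fun_prop
  have := le_of_tendsto hlim (by
    filter_upwards [Ioo_mem_nhdsGT (show (0 : ℝ) < 1 by norm_num)] with t ht
    exact h1 t ht.1 ht.2)
  simpa [hq] using this

theorem proxStep_subdiff (hX : IsCompact X) (hne : X.Nonempty) (hh : ConvexOn ℝ X h)
    (hlsc : LowerSemicontinuousOn h X) (L : ℝ) (ξ u : Vec n) :
    -ξ - L • (proxStep X h L ξ u - u) ∈ subdiff X h (proxStep X h L ξ u) := by
  refine ⟨(proxStep_spec hX hne hlsc L ξ u).1, fun z hz => ?_⟩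
  have h3 := proxStep_three_point hX hh hlsc L ξ u hz
  set p := proxStep X h L ξ u
  have e : ‖z - u‖ ^ 2 = ‖z - p‖ ^ 2 + 2 * ⟪p - u, z - p⟫_ℝ + ‖p - u‖ ^ 2 := by
    rw [show z - u = (z - p) + (p - u) by abel, norm_add_sq_real, real_inner_comm]
  rw [e] at h3
  rw [inner_sub_left, inner_neg_left, real_inner_smul_left, inner_sub_right ξ]
  linarith

end Prox

/-! ### Linear convergence of the accelerated proximal gradient method. -/

section APG

variable {n : ℕ}

/-- The set of extrapolations `2x - x'` of pairs of points of `X`. -/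
def extrap (X : Set (Vec n)) : Set (Vec n) := {w | ∃ x ∈ X, ∃ x' ∈ X, w = (2 : ℝ) • x - x'}

theorem subset_extrap {X : Set (Vec n)} {x : Vec n} (hx : x ∈ X) : x ∈ extrap X :=
  ⟨x, hx, x, hx, by module⟩

theorem extrap_convex {X : Set (Vec n)} (hX : Convex ℝ X) : Convex ℝ (extrap X) := by
  rintro _ ⟨a, ha, a', ha', rfl⟩ _ ⟨b, hb, b', hb', rfl⟩ p q hp hq hpq
  exact ⟨p • a + q • b, hX ha hb hp hq hpq, p • a' + q • b', hX ha' hb' hp hq hpq, by module⟩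

/-- The momentum factor lies in [0, 1], so extrapolated points stay where `c` and its gradients are
bounded by `B`. The augmented Lagrangian need not be globally smooth, so the models below only
assume their inequalities with base point in `extrap X`. -/
theorem add_smul_sub_mem_extrap {X : Set (Vec n)} (hX : Convex ℝ X) {x x' : Vec n} (hx : x ∈ X)
    (hx' : x' ∈ X) {θ : ℝ} (h0 : 0 ≤ θ) (h1 : θ ≤ 1) : x' + θ • (x' - x) ∈ extrap X :=
  ⟨x', hx', (1 - θ) • x' + θ • x, hX hx' hx (by linarith) h0 (by ring), by module⟩

/-- The hypotheses on `G + h` under which APG with parameters `μ`, `L` is analysed. -/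
structure CompositeModel (X : Set (Vec n)) (h G : Vec n → ℝ) (μ L : ℝ) : Prop where
  compact : IsCompact X
  convex : ConvexOn ℝ X h
  lsc : LowerSemicontinuousOn h X
  cont : ContinuousOn G X
  μ_pos : 0 < μ
  μ_lt : μ < L
  lower : ∀ x ∈ extrap X, ∀ z ∈ X,
    G x + ⟪gradient G x, z - x⟫_ℝ + μ / 2 * ‖z - x‖ ^ 2 ≤ G z
  upper : ∀ x ∈ extrap X, ∀ z ∈ X,
    G z ≤ G x + ⟪gradient G x, z - x⟫_ℝ + L / 2 * ‖z - x‖ ^ 2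
  lip : ∀ x ∈ extrap X, ∀ z ∈ X, ‖gradient G z - gradient G x‖ ≤ L * ‖z - x‖

namespace CompositeModel

variable {X : Set (Vec n)} {h G : Vec n → ℝ} {μ L : ℝ} (M : CompositeModel X h G μ L)

include M

theorem L_pos : 0 < L := M.μ_pos.trans M.μ_lt

theorem momentum_pos : 0 < Real.sqrt (μ / L) := Real.sqrt_pos.2 (div_pos M.μ_pos M.L_pos)

theorem momentum_lt_one : Real.sqrt (μ / L) < 1 := by
  rw [Real.sqrt_lt' one_pos, div_lt_iff₀ M.L_pos]
  linarith [M.μ_lt]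

theorem L_mul_momentum_sq : L * Real.sqrt (μ / L) ^ 2 = μ := by
  rw [Real.sq_sqrt (div_pos M.μ_pos M.L_pos).le]
  field_simp [M.L_pos.ne']

theorem apgState_fst_mem {u : Vec n} (hu : u ∈ X) (t : ℕ) : (apgState X h G μ L u t).1 ∈ X := by
  cases t with
  | zero => exact (proxStep_spec M.compact ⟨u, hu⟩ M.lsc _ _ _).1
  | succ t => exact (proxStep_spec M.compact ⟨u, hu⟩ M.lsc _ _ _).1

theorem apgState_snd_mem {u : Vec n} (hu : u ∈ X) (t : ℕ) :
    (apgState X h G μ L u t).2 ∈ extrap X := by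
  cases t with
  | zero => exact subset_extrap (M.apgState_fst_mem hu 0)
  | succ t =>
    have h0 := M.momentum_pos
    have h1 := M.momentum_lt_one
    refine add_smul_sub_mem_extrap M.convex.1 (M.apgState_fst_mem hu t)
      (M.apgState_fst_mem hu (t + 1)) ?_ ?_
    · exact div_nonneg (by linarith) (by linarith)
    · rw [div_le_one (by linarith)]
      linarith

/-- The basic inequality for a proximal gradient step. -/
theorem prox_descent {w z : Vec n} (hw : w ∈ extrap X) (hz : z ∈ X) :
    G (proxStep X h L (gradient G w) w) + h (proxStep X h L (gradient G w) w)
      + L / 2 * ‖z - proxStep X h L (gradient G w) w‖ ^ 2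
      ≤ G z + h z + (L - μ) / 2 * ‖z - w‖ ^ 2 := by
  have hp := (proxStep_spec M.compact ⟨z, hz⟩ M.lsc L (gradient G w) w).1
  have h3 := proxStep_three_point M.compact M.convex M.lsc L (gradient G w) w hz
  have h1 := M.lower w hw z hz
  have h2 := M.upper w hw _ hp
  rw [inner_sub_right] at h1 h2
  linarith

theorem strong_convexity {x y : Vec n} (hx : x ∈ X) (hy : y ∈ X) {α : ℝ} (h0 : 0 ≤ α)
    (h1 : α ≤ 1) :
    (1 - α) • x + α • y ∈ X ∧ G ((1 - α) • x + α • y) + h ((1 - α) • x + α • y) ≤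
      (1 - α) * (G x + h x) + α * (G y + h y) - μ / 2 * (α * (1 - α)) * ‖y - x‖ ^ 2 := by
  have hz : (1 - α) • x + α • y ∈ X := M.convex.1 hx hy (by linarith) h0 (by ring)
  refine ⟨hz, ?_⟩
  have hh := M.convex.2 hx hy (show 0 ≤ 1 - α by linarith) h0 (by ring)
  have gx := M.lower _ (subset_extrap hz) x hx
  have gy := M.lower _ (subset_extrap hz) y hy
  simp only [smul_eq_mul] at hh
  set z := (1 - α) • x + α • y with hzdef
  have ex : x - z = (-α) • (y - x) := by rw [hzdef]; module
  have ey : y - z = (1 - α) • (y - x) := by rw [hzdef]; module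
  rw [ex, real_inner_smul_right, norm_smul, mul_pow, Real.norm_eq_abs, sq_abs] at gx
  rw [ey, real_inner_smul_right, norm_smul, mul_pow, Real.norm_eq_abs, sq_abs] at gy
  have gx' := mul_le_mul_of_nonneg_left gx (show 0 ≤ 1 - α by linarith)
  have gy' := mul_le_mul_of_nonneg_left gy h0
  nlinarith

theorem exists_minimizer (hne : X.Nonempty) : ∃ y ∈ X, ∀ z ∈ X, G y + h y ≤ G z + h z :=
  LowerSemicontinuousOn.exists_isMinOn hne M.compact (M.cont.lowerSemicontinuousOn.add M.lsc)

theorem quadratic_growth {y : Vec n} (hy : y ∈ X) (hmin : ∀ z ∈ X, G y + h y ≤ G z + h z)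
    {x : Vec n} (hx : x ∈ X) : μ / 4 * ‖x - y‖ ^ 2 ≤ G x + h x - (G y + h y) := by
  obtain ⟨hz, hle⟩ := M.strong_convexity hx hy (α := 1 / 2) (by norm_num) (by norm_num)
  -- Comparison with the midpoint suffices; it costs a factor 2 in the growth constant.
  have := hmin _ hz
  rw [norm_sub_rev]
  linarith

/-- One step of the Lyapunov analysis of APG. -/
theorem lyapunov_step {x w y p : Vec n} (hx : x ∈ X) (hw : w ∈ extrap X) (hy : y ∈ X)
    (hp : (1 - Real.sqrt (μ / L)) • x + Real.sqrt (μ / L) • y - w =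
      (1 - Real.sqrt (μ / L) / (1 + Real.sqrt (μ / L))) • p +
        (Real.sqrt (μ / L) / (1 + Real.sqrt (μ / L))) • (Real.sqrt (μ / L) • (y - x))) :
    G (proxStep X h L (gradient G w) w) + h (proxStep X h L (gradient G w) w) - (G y + h y)
      + L / 2 * ‖(1 - Real.sqrt (μ / L)) • x + Real.sqrt (μ / L) • y
        - proxStep X h L (gradient G w) w‖ ^ 2
      ≤ (1 - Real.sqrt (μ / L)) * (G x + h x - (G y + h y) + L / 2 * ‖p‖ ^ 2) := by
  have ha0 := M.momentum_pos
  have ha1 := M.momentum_lt_one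
  have hLa := M.L_mul_momentum_sq
  set a := Real.sqrt (μ / L)
  obtain ⟨hz, hsc⟩ := M.strong_convexity hx hy ha0.le ha1.le
  have hd := M.prox_descent hw hz
  set q := proxStep X h L (gradient G w) w
  have hn : ‖(1 - a) • x + a • y - w‖ ^ 2 ≤
      1 / (1 + a) * ‖p‖ ^ 2 + a / (1 + a) * (a ^ 2 * ‖y - x‖ ^ 2) := by
    rw [hp, norm_sq_convexCombo]
    have h1 : 0 ≤ a / (1 + a) * (1 - a / (1 + a)) * ‖p - a • (y - x)‖ ^ 2 := by
      have : a / (1 + a) ≤ 1 := by rw [div_le_one (by linarith)]; linarith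
      have h2 : 0 ≤ a / (1 + a) := by positivity
      exact mul_nonneg (mul_nonneg h2 (by linarith)) (sq_nonneg _)
    have h2 : 1 - a / (1 + a) = 1 / (1 + a) := by field_simp; ring
    have h3 : ‖a • (y - x)‖ ^ 2 = a ^ 2 * ‖y - x‖ ^ 2 := by
      rw [norm_smul, mul_pow, Real.norm_eq_abs, sq_abs]
    rw [h3]
    rw [h2] at h1 ⊢
    linarith
  -- Since μ = L a², the ‖y - x‖² part of `hn` becomes exactly the gain μ/2 · a(1 - a)‖y - x‖² from
  -- strong convexity at the point (1 - a)x + ay, and the two cancel.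
  have hLμ : L - μ = L * (1 - a) * (1 + a) := by rw [← hLa]; ring
  have hn' : (L - μ) / 2 * ‖(1 - a) • x + a • y - w‖ ^ 2 ≤
      (1 - a) * (L / 2 * ‖p‖ ^ 2) + μ / 2 * (a * (1 - a)) * ‖y - x‖ ^ 2 := by
    refine (mul_le_mul_of_nonneg_left hn (by linarith [M.μ_lt])).trans (le_of_eq ?_)
    rw [hLμ, ← hLa]
    field_simp
  linarith

/-- The vector p is existential because its formula changes: it is a(y - x⁰) at the start and (1 -
a)xᵗ + ay - xᵗ⁺¹ afterwards, with a = √(μ/L). The identity is the hypothesis of `lyapunov_step`; the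
momentum coefficient (1 - a)/(1 + a) is what makes it reproduce itself. -/
theorem lyapunov_bound {u y : Vec n} {D : ℝ} (hu : u ∈ X) (hy : y ∈ X)
    (hD : ∀ a ∈ X, ∀ b ∈ X, ‖a - b‖ ≤ D) (t : ℕ) :
    ∃ p : Vec n, (1 - Real.sqrt (μ / L)) • (apgState X h G μ L u t).1 + Real.sqrt (μ / L) • y
        - (apgState X h G μ L u t).2 =
      (1 - Real.sqrt (μ / L) / (1 + Real.sqrt (μ / L))) • p +
        (Real.sqrt (μ / L) / (1 + Real.sqrt (μ / L))) •
          (Real.sqrt (μ / L) • (y - (apgState X h G μ L u t).1)) ∧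
      G (apgState X h G μ L u t).1 + h (apgState X h G μ L u t).1 - (G y + h y)
        + L / 2 * ‖p‖ ^ 2 ≤ (1 - Real.sqrt (μ / L)) ^ t * (L / 2 * D ^ 2) := by
  have ha0 := M.momentum_pos
  have ha1 := M.momentum_lt_one
  have hLa := M.L_mul_momentum_sq
  induction t with
  | zero =>
    refine ⟨Real.sqrt (μ / L) • (y - (apgState X h G μ L u 0).1), ?_, ?_⟩
    · simp only [apgState]
      module
    · have hd := M.prox_descent (subset_extrap hu) hy
      change G (proxStep X h L (gradient G u) u) + h (proxStep X h L (gradient G u) u)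
        - (G y + h y) + L / 2 * ‖Real.sqrt (μ / L) • (y - proxStep X h L (gradient G u) u)‖ ^ 2
        ≤ _
      set q := proxStep X h L (gradient G u) u
      rw [norm_smul, mul_pow, Real.norm_eq_abs, sq_abs, pow_zero, one_mul]
      have h1 : ‖y - u‖ ^ 2 ≤ D ^ 2 := pow_le_pow_left₀ (norm_nonneg _) (hD y hy u hu) 2
      have h2 : L / 2 * (Real.sqrt (μ / L) ^ 2 * ‖y - q‖ ^ 2) ≤ L / 2 * ‖y - q‖ ^ 2 := by
        have : L / 2 * (Real.sqrt (μ / L) ^ 2 * ‖y - q‖ ^ 2) = μ / 2 * ‖y - q‖ ^ 2 := by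
          linear_combination (1 / 2 * ‖y - q‖ ^ 2) * hLa
        rw [this]
        gcongr
        exact M.μ_lt.le
      have h3 : (L - μ) / 2 * ‖y - u‖ ^ 2 ≤ L / 2 * D ^ 2 := by
        have := M.μ_lt
        have := M.μ_pos
        gcongr
        · linarith
        · linarith
      linarith
  | succ t ih =>
    obtain ⟨p, hp, hV⟩ := ih
    have hstep := M.lyapunov_step (M.apgState_fst_mem hu t) (M.apgState_snd_mem hu t) hy hp
    refine ⟨(1 - Real.sqrt (μ / L)) • (apgState X h G μ L u t).1 + Real.sqrt (μ / L) • y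
      - (apgState X h G μ L u (t + 1)).1, ?_, hstep.trans ?_⟩
    · have hs2 : (apgState X h G μ L u (t + 1)).2 = (apgState X h G μ L u (t + 1)).1 +
          ((1 - Real.sqrt (μ / L)) / (1 + Real.sqrt (μ / L))) •
            ((apgState X h G μ L u (t + 1)).1 - (apgState X h G μ L u t).1) := rfl
      rw [hs2]
      set a := Real.sqrt (μ / L)
      match_scalars <;> field_simp <;> ring
    · rw [pow_succ' (1 - Real.sqrt (μ / L)) t]
      have := mul_le_mul_of_nonneg_left hV (show 0 ≤ 1 - Real.sqrt (μ / L) by linarith)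
      linarith

theorem apg_dist_sq_le {u y : Vec n} {D : ℝ} (hu : u ∈ X) (hy : y ∈ X)
    (hmin : ∀ z ∈ X, G y + h y ≤ G z + h z) (hD : ∀ a ∈ X, ∀ b ∈ X, ‖a - b‖ ≤ D) (t : ℕ) :
    μ * ‖(apgState X h G μ L u t).1 - y‖ ^ 2 ≤
      2 * L * D ^ 2 * Real.exp (-(Real.sqrt (μ / L) * t)) := by
  obtain ⟨p, -, hV⟩ := M.lyapunov_bound hu hy hD t
  have hg := M.quadratic_growth hy hmin (M.apgState_fst_mem hu t)
  have hL := M.L_pos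
  have hp : 0 ≤ L / 2 * ‖p‖ ^ 2 := by positivity
  have hexp : (1 - Real.sqrt (μ / L)) ^ t ≤ Real.exp (-(Real.sqrt (μ / L) * t)) := by
    have h1 : 1 - Real.sqrt (μ / L) ≤ Real.exp (-Real.sqrt (μ / L)) := by
      have := Real.add_one_le_exp (-Real.sqrt (μ / L))
      linarith
    refine (pow_le_pow_left₀ (by linarith [M.momentum_lt_one]) h1 t).trans (le_of_eq ?_)
    rw [← Real.exp_nat_mul]
    ring_nf
  have := mul_le_mul_of_nonneg_right hexp (show 0 ≤ L / 2 * D ^ 2 by positivity)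
  linarith

/-- The proximal step supplies a subgradient whose residual is at most 2L‖x^{s+2} - w‖, where w
extrapolates x^s and x^{s+1}. If these three iterates are within ε/(8L) of the minimizer, the gap is
at most 4ε/(8L) and the residual at most ε. The constant 128 = 2 · 64 comes from squaring ε/(8L) in
`apg_dist_sq_le`. -/
theorem mem_apgStopSet_of_le {u : Vec n} {D ε : ℝ} (hu : u ∈ X) (hD : ∀ a ∈ X, ∀ b ∈ X, ‖a - b‖ ≤ D)
    (hε : 0 ≤ ε) (s : ℕ)
    (hs : 128 * L ^ 3 * D ^ 2 ≤ ε ^ 2 * μ * Real.exp (Real.sqrt (μ / L) * s)) :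
    s + 2 ∈ apgStopSet X h G μ L u ε := by
  refine ⟨by omega, ?_⟩
  obtain ⟨y, hy, hmin⟩ := M.exists_minimizer ⟨u, hu⟩
  have hμ := M.μ_pos
  have hL := M.L_pos
  have hsub := proxStep_subdiff M.compact ⟨u, hu⟩ M.convex M.lsc L
    (gradient G (apgState X h G μ L u (s + 1)).2) (apgState X h G μ L u (s + 1)).2
  have hdist : ∀ t, s ≤ t → ‖(apgState X h G μ L u t).1 - y‖ ≤ ε / (8 * L) := by
    intro t hst
    have h1 := M.apg_dist_sq_le hu hy hmin hD t
    have h2 : Real.exp (-(Real.sqrt (μ / L) * t)) ≤ Real.exp (-(Real.sqrt (μ / L) * s)) := by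
      gcongr
    have h3 : Real.exp (Real.sqrt (μ / L) * s) * Real.exp (-(Real.sqrt (μ / L) * s)) = 1 := by
      rw [← Real.exp_add, add_neg_cancel, Real.exp_zero]
    have hE := Real.exp_pos (-(Real.sqrt (μ / L) * s))
    have h4 := mul_le_mul_of_nonneg_right hs hE.le
    rw [mul_assoc (ε ^ 2 * μ), h3, mul_one] at h4
    have h5 : μ * ‖(apgState X h G μ L u t).1 - y‖ ^ 2 ≤ μ * (ε / (8 * L)) ^ 2 := by
      refine h1.trans ((mul_le_mul_of_nonneg_left h2 (by positivity)).trans ?_)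
      rw [div_pow, ← mul_div_assoc, le_div_iff₀ (by positivity)]
      nlinarith
    exact le_of_sq_le_sq (le_of_mul_le_mul_left h5 hμ) (by positivity)
  set x0 := (apgState X h G μ L u s).1 with hx0
  set x1 := (apgState X h G μ L u (s + 1)).1 with hx1
  set w := (apgState X h G μ L u (s + 1)).2 with hw
  change Metric.infEDist (-gradient G (proxStep X h L (gradient G w) w))
    (subdiff X h (proxStep X h L (gradient G w) w)) ≤ _
  have hx2 : ‖proxStep X h L (gradient G w) w - y‖ ≤ ε / (8 * L) := hdist (s + 2) (by omega)
  set x2 := proxStep X h L (gradient G w) w with hx2def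
  have hx2X : x2 ∈ X := hsub.1
  have ha0 := M.momentum_pos
  have ha1 := M.momentum_lt_one
  have hwe : w = x1 + ((1 - Real.sqrt (μ / L)) / (1 + Real.sqrt (μ / L))) • (x1 - x0) := rfl
  set θ := (1 - Real.sqrt (μ / L)) / (1 + Real.sqrt (μ / L)) with hθ
  have hθ0 : 0 ≤ θ := div_nonneg (by linarith) (by linarith)
  have hθ1 : θ ≤ 1 := by
    rw [hθ, div_le_one (by linarith)]
    linarith
  have hd0 := hdist s le_rfl
  have hd1 := hdist (s + 1) (by omega)
  have hgap : ‖x2 - w‖ ≤ 4 * (ε / (8 * L)) := by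
    have e : x2 - w = (x2 - y) - (x1 - y) - θ • ((x1 - y) - (x0 - y)) := by
      rw [hwe]
      module
    have h1 : ‖θ • ((x1 - y) - (x0 - y))‖ ≤ ‖x1 - y‖ + ‖x0 - y‖ := by
      rw [norm_smul, Real.norm_eq_abs, abs_of_nonneg hθ0]
      exact (mul_le_of_le_one_left (norm_nonneg _) hθ1).trans (norm_sub_le _ _)
    have h2 := norm_sub_le ((x2 - y) - (x1 - y)) (θ • ((x1 - y) - (x0 - y)))
    have h3 := norm_sub_le (x2 - y) (x1 - y)
    rw [e]
    linarith
  refine (Metric.infEDist_le_edist_of_mem hsub).trans ?_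
  rw [edist_dist, dist_eq_norm]
  apply ENNReal.ofReal_le_ofReal
  have hl := M.lip w (M.apgState_snd_mem hu (s + 1)) x2 hx2X
  have e : -gradient G x2 - (-gradient G w - L • (x2 - w)) =
      L • (x2 - w) - (gradient G x2 - gradient G w) := by abel
  rw [e]
  refine (norm_sub_le _ _).trans ?_
  rw [norm_smul, Real.norm_eq_abs, abs_of_pos hL]
  have h6 : L * ‖x2 - w‖ ≤ L * (4 * (ε / (8 * L))) := by gcongr
  have h7 : L * (4 * (ε / (8 * L))) = ε / 2 := by field_simp; ring
  linarith

theorem apgOut_mem {u : Vec n} (hu : u ∈ X) (ε : ℝ) : apgOut X h G μ L u ε ∈ X :=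
  M.apgState_fst_mem hu _

theorem apgStopSet_nonempty {u : Vec n} (hu : u ∈ X) {ε : ℝ} (hε : 0 < ε) :
    (apgStopSet X h G μ L u ε).Nonempty := by
  obtain ⟨D, hD⟩ := Metric.isBounded_iff.1 M.compact.isBounded
  have hμ := M.μ_pos
  have hlim : Filter.Tendsto (fun s : ℕ => ε ^ 2 * μ * Real.exp (Real.sqrt (μ / L) * s))
      Filter.atTop Filter.atTop :=
    (Real.tendsto_exp_atTop.comp
      (tendsto_natCast_atTop_atTop.const_mul_atTop M.momentum_pos)).const_mul_atTop (by positivity)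
  obtain ⟨s, hs⟩ := (hlim.eventually_ge_atTop (128 * L ^ 3 * D ^ 2)).exists
  exact ⟨s + 2, M.mem_apgStopSet_of_le hu (fun a ha b hb => by
    rw [← dist_eq_norm]; exact hD ha hb) hε.le s hs⟩

/-- The output of APG is approximately stationary. -/
theorem apgOut_residual {u : Vec n} (hu : u ∈ X) {ε δ : ℝ} (hε : 0 < ε) (hδ : ε < δ) :
    ∃ s ∈ subdiff X h (apgOut X h G μ L u ε), ‖s + gradient G (apgOut X h G μ L u ε)‖ ≤ δ := by
  have hmem := (Nat.sInf_mem (M.apgStopSet_nonempty hu hε)).2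
  -- The strict excess of δ over ε turns a bound on an infimum into an actual subgradient.
  have hlt := hmem.trans_lt ((ENNReal.ofReal_lt_ofReal_iff (hε.trans hδ)).2 hδ)
  obtain ⟨s, hs, hd⟩ := Metric.infEDist_lt_iff.1 hlt
  refine ⟨s, hs, ?_⟩
  rw [edist_dist, ENNReal.ofReal_lt_ofReal_iff (hε.trans hδ), dist_eq_norm, ← norm_neg] at hd
  have e : s + gradient G (apgOut X h G μ L u ε) =
      -(-gradient G (apgOut X h G μ L u ε) - s) := by abel
  rw [e]
  exact hd.le

theorem apgIters_le {u : Vec n} {D ε : ℝ} (hu : u ∈ X) (hD : ∀ a ∈ X, ∀ b ∈ X, ‖a - b‖ ≤ D)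
    (hε : 0 < ε) {Λ : ℝ} (hΛ : 0 ≤ Λ) (h1 : 128 * L ^ 3 * D ^ 2 ≤ ε ^ 2 * μ * Real.exp Λ) :
    (apgIters X h G μ L u ε : ℝ) ≤ Real.sqrt (L / μ) * Λ + 3 := by
  have hμ := M.μ_pos
  have hinv : Real.sqrt (μ / L) * Real.sqrt (L / μ) = 1 := by
    rw [← Real.sqrt_mul (div_pos M.μ_pos M.L_pos).le, div_mul_div_comm, mul_comm L μ,
      div_self (mul_pos M.μ_pos M.L_pos).ne', Real.sqrt_one]
  set s := ⌈Real.sqrt (L / μ) * Λ⌉₊ with hs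
  have hle : Λ ≤ Real.sqrt (μ / L) * s := by
    have := mul_le_mul_of_nonneg_left (Nat.le_ceil (Real.sqrt (L / μ) * Λ)) M.momentum_pos.le
    rwa [← mul_assoc, hinv, one_mul] at this
  have hmem := M.mem_apgStopSet_of_le hu hD hε.le s (h1.trans (by gcongr))
  have h2 : (apgIters X h G μ L u ε : ℝ) ≤ ((s + 2 : ℕ) : ℝ) := Nat.cast_le.2 (Nat.sInf_le hmem)
  have h3 := Nat.ceil_lt_add_one (show 0 ≤ Real.sqrt (L / μ) * Λ by positivity)
  push_cast at h2
  linarith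

end CompositeModel

end APG

/-! ### Descent and iteration count of the inexact proximal point method. -/

section IPPM

variable {n : ℕ}

theorem hasGradientAt_norm_sub_sq (p x : Vec n) :
    HasGradientAt (fun z : Vec n => ‖z - p‖ ^ 2) ((2 : ℝ) • (x - p)) x := by
  rw [hasGradientAt_iff_hasFDerivAt]
  have := ((hasFDerivAt_id (𝕜 := ℝ) x).sub_const p).norm_sq
  refine this.congr_fderiv ?_
  ext v
  simp [two_smul]

theorem norm_sub_sq_expand (x z p : Vec n) :
    ‖z - p‖ ^ 2 = ‖z - x‖ ^ 2 + 2 * ⟪x - p, z - x⟫_ℝ + ‖x - p‖ ^ 2 := by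
  rw [show z - p = (z - x) + (x - p) by abel, norm_add_sq_real, real_inner_comm]

theorem gradient_ippmModel {φ : Vec n → ℝ} (hφ : Differentiable ℝ φ) (ρ : ℝ) (p x : Vec n) :
    gradient (ippmModel φ ρ p) x = gradient φ x + (2 * ρ) • (x - p) := by
  have h1 := (hφ x).hasGradientAt.hasFDerivAt
  have h2 := (hasGradientAt_norm_sub_sq p x).hasFDerivAt.const_mul ρ
  have h3 : HasGradientAt (ippmModel φ ρ p) (gradient φ x + (2 * ρ) • (x - p)) x := by
    rw [hasGradientAt_iff_hasFDerivAt]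
    refine (h1.add h2).congr_fderiv ?_
    rw [← map_smul, ← map_add, smul_smul, mul_comm ρ 2]
  exact h3.gradient

/-- The hypotheses on `φ + h` under which iPPM with parameters `ρ`, `L` is analysed. -/
structure WeakModel (X : Set (Vec n)) (h φ : Vec n → ℝ) (ρ L : ℝ) : Prop where
  compact : IsCompact X
  convex : ConvexOn ℝ X h
  lsc : LowerSemicontinuousOn h X
  diff : Differentiable ℝ φ
  ρ_pos : 0 < ρ
  L_nonneg : 0 ≤ L
  lower : ∀ x ∈ extrap X, ∀ z ∈ X,
    φ x + ⟪gradient φ x, z - x⟫_ℝ - ρ / 2 * ‖z - x‖ ^ 2 ≤ φ z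
  upper : ∀ x ∈ extrap X, ∀ z ∈ X,
    φ z ≤ φ x + ⟪gradient φ x, z - x⟫_ℝ + L / 2 * ‖z - x‖ ^ 2
  lip : ∀ x ∈ extrap X, ∀ z ∈ X, ‖gradient φ z - gradient φ x‖ ≤ L * ‖z - x‖

namespace WeakModel

variable {X : Set (Vec n)} {h φ : Vec n → ℝ} {ρ L : ℝ} (W : WeakModel X h φ ρ L)

include W

/-- The proximal term has curvature 2ρ, which outweighs weak convexity ρ and leaves strong convexity
ρ. -/
theorem compositeModel (p : Vec n) : CompositeModel X h (ippmModel φ ρ p) ρ (L + 2 * ρ) where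
  compact := W.compact
  convex := W.convex
  lsc := W.lsc
  cont := by
    have := W.diff.continuous
    unfold ippmModel
    fun_prop
  μ_pos := W.ρ_pos
  μ_lt := by linarith [W.ρ_pos, W.L_nonneg]
  lower x hx z hz := by
    have h1 := W.lower x hx z hz
    rw [gradient_ippmModel W.diff, inner_add_left, real_inner_smul_left]
    unfold ippmModel
    rw [norm_sub_sq_expand x z p]
    linarith
  upper x hx z hz := by
    have h1 := W.upper x hx z hz
    rw [gradient_ippmModel W.diff, inner_add_left, real_inner_smul_left]
    unfold ippmModel
    rw [norm_sub_sq_expand x z p]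
    linarith
  lip x hx z hz := by
    have h1 := W.lip x hx z hz
    have h2 := W.ρ_pos
    rw [gradient_ippmModel W.diff, gradient_ippmModel W.diff]
    have e : gradient φ z + (2 * ρ) • (z - p) - (gradient φ x + (2 * ρ) • (x - p)) =
      (gradient φ z - gradient φ x) + (2 * ρ) • (z - x) := by module
    rw [e]
    refine (norm_add_le _ _).trans ?_
    rw [norm_smul, Real.norm_eq_abs, abs_of_pos (by positivity)]
    linarith

variable {x₀ : Vec n} {ε : ℝ} {init : ℕ → Vec n}

theorem ippmIter_mem (hx₀ : x₀ ∈ X) (hinit : ∀ t, init t ∈ X) (t : ℕ) :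
    ippmIter X h φ x₀ ρ L ε init t ∈ X := by
  cases t with
  | zero => exact hx₀
  | succ t => exact (W.compositeModel _).apgOut_mem (hinit t) _

theorem ippmIter_residual (hinit : ∀ t, init t ∈ X) (hε : 0 < ε) (t : ℕ) :
    ∃ s ∈ subdiff X h (ippmIter X h φ x₀ ρ L ε init (t + 1)),
      ‖s + (gradient φ (ippmIter X h φ x₀ ρ L ε init (t + 1)) + (2 * ρ) •
        (ippmIter X h φ x₀ ρ L ε init (t + 1) - ippmIter X h φ x₀ ρ L ε init t))‖
        ≤ 5 * ε / 16 := by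
  have := (W.compositeModel (ippmIter X h φ x₀ ρ L ε init t)).apgOut_residual (hinit t)
    (show 0 < ε / 4 by linarith) (show ε / 4 < 5 * ε / 16 by linarith)
  rw [gradient_ippmModel W.diff] at this
  exact this

/-- With d the step length, the proximal term gains 2ρd² and weak convexity loses ρd²/2. A failed
test means d > ε/(4ρ), so the residual loses at most (5ε/16)d ≤ (5/4)ρd². What remains is ρd²/4 ≥
ε²/(64ρ). -/
theorem ippm_descent (hx₀ : x₀ ∈ X) (hinit : ∀ t, init t ∈ X) (hε : 0 < ε) {t : ℕ}
    (ht : t + 1 ∉ ippmStopSet X h φ x₀ ρ L ε init) :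
    φ (ippmIter X h φ x₀ ρ L ε init (t + 1)) + h (ippmIter X h φ x₀ ρ L ε init (t + 1))
      + ε ^ 2 / (64 * ρ) ≤
      φ (ippmIter X h φ x₀ ρ L ε init t) + h (ippmIter X h φ x₀ ρ L ε init t) := by
  have hρ := W.ρ_pos
  obtain ⟨s, hs, hres⟩ := W.ippmIter_residual (x₀ := x₀) hinit hε t
  have hX0 := W.ippmIter_mem (ε := ε) hx₀ hinit t
  have hX1 := W.ippmIter_mem (ε := ε) hx₀ hinit (t + 1)
  have hns : ¬ 2 * ρ * ‖ippmIter X h φ x₀ ρ L ε init (t + 1) - ippmIter X h φ x₀ ρ L ε init t‖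
      ≤ ε / 2 := fun hc => ht ⟨t, rfl, hc⟩
  set x := ippmIter X h φ x₀ ρ L ε init t
  set x' := ippmIter X h φ x₀ ρ L ε init (t + 1)
  have hl := W.lower x' (subset_extrap hX1) x hX0
  have hsx := hs.2 x hX0
  have hin : ⟪s + (gradient φ x' + (2 * ρ) • (x' - x)), x - x'⟫_ℝ =
      ⟪s, x - x'⟫_ℝ + ⟪gradient φ x', x - x'⟫_ℝ - 2 * ρ * ‖x' - x‖ ^ 2 := by
    rw [inner_add_left, inner_add_left, real_inner_smul_left, ← neg_sub x' x,
      inner_neg_right (x' - x), real_inner_self_eq_norm_sq]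
    ring
  have hcs := neg_le_of_abs_le (abs_real_inner_le_norm
    (s + (gradient φ x' + (2 * ρ) • (x' - x))) (x - x'))
  rw [hin] at hcs
  rw [norm_sub_rev x x'] at hl hcs
  set d := ‖x' - x‖
  have hd0 : 0 ≤ d := norm_nonneg _
  have h1 : ‖s + (gradient φ x' + (2 * ρ) • (x' - x))‖ * d ≤ 5 * ε / 16 * d := by gcongr
  have hd : ε / (4 * ρ) < d := by
    rw [div_lt_iff₀ (by positivity)]
    linarith
  have h2 : ε * d ≤ 4 * ρ * d * d := by
    gcongr
    linarith
  have h3 : ε ^ 2 / (64 * ρ) ≤ ρ / 4 * d ^ 2 := by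
    have h4 : (ε / (4 * ρ)) ^ 2 ≤ d ^ 2 := pow_le_pow_left₀ (by positivity) hd.le 2
    have h5 : ε ^ 2 / (64 * ρ) = ρ / 4 * (ε / (4 * ρ)) ^ 2 := by
      field_simp
      norm_num
    rw [h5]
    gcongr
  nlinarith

theorem ippm_descent_sum (hx₀ : x₀ ∈ X) (hinit : ∀ t, init t ∈ X) (hε : 0 < ε) {m : ℕ}
    (hm : ∀ t < m, t + 1 ∉ ippmStopSet X h φ x₀ ρ L ε init) :
    φ (ippmIter X h φ x₀ ρ L ε init m) + h (ippmIter X h φ x₀ ρ L ε init m)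
      + m * (ε ^ 2 / (64 * ρ)) ≤ φ x₀ + h x₀ := by
  induction m with
  | zero => simp [ippmIter]
  | succ m ih =>
    have h1 := ih fun t ht => hm t (by omega)
    have h2 := W.ippm_descent hx₀ hinit hε (hm m (by omega))
    push_cast
    linarith

theorem ippmStop_bound (hx₀ : x₀ ∈ X) (hinit : ∀ t, init t ∈ X) (hε : 0 < ε) {Δ : ℝ}
    (hΔ : ∀ z ∈ X, φ x₀ + h x₀ - (φ z + h z) ≤ Δ) :
    (ippmStopSet X h φ x₀ ρ L ε init).Nonempty ∧
      (ippmIters X h φ x₀ ρ L ε init : ℝ) ≤ 64 * ρ * Δ / ε ^ 2 + 1 := by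
  have hρ := W.ρ_pos
  have hm : ∀ m : ℕ, (∀ t < m, t + 1 ∉ ippmStopSet X h φ x₀ ρ L ε init) →
      (m : ℝ) ≤ 64 * ρ * Δ / ε ^ 2 := by
    intro m hm
    have h1 := W.ippm_descent_sum hx₀ hinit hε hm
    have h2 := hΔ _ (W.ippmIter_mem (ε := ε) hx₀ hinit m)
    have h3 : m * (ε ^ 2 / (64 * ρ)) ≤ Δ := by linarith
    rw [le_div_iff₀ (by positivity)]
    rw [← mul_div_assoc, div_le_iff₀ (by positivity)] at h3
    linarith
  have hne : (ippmStopSet X h φ x₀ ρ L ε init).Nonempty := by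
    by_contra hne
    rw [Set.not_nonempty_iff_eq_empty] at hne
    obtain ⟨m, hlt⟩ := exists_nat_gt (64 * ρ * Δ / ε ^ 2)
    exact absurd (hm m fun t _ => by rw [hne]; exact Set.notMem_empty _) (not_le.2 hlt)
  refine ⟨hne, ?_⟩
  -- The last step passes the test and need not decrease the objective; only the t steps before it
  -- are counted, whence the + 1.
  obtain ⟨t, ht, -⟩ := Nat.sInf_mem hne
  have h1 := hm t fun s hs hmem => by
    have := Nat.sInf_le hmem
    omega
  change ((sInf (ippmStopSet X h φ x₀ ρ L ε init) : ℕ) : ℝ) ≤ _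
  rw [ht]
  push_cast
  linarith

theorem exists_gap_bound (x₀ : Vec n) (hne : X.Nonempty) :
    ∃ Δ, ∀ z ∈ X, φ x₀ + h x₀ - (φ z + h z) ≤ Δ := by
  obtain ⟨y, -, hy⟩ := LowerSemicontinuousOn.exists_isMinOn hne W.compact
    (W.diff.continuous.continuousOn.lowerSemicontinuousOn.add W.lsc)
  exact ⟨φ x₀ + h x₀ - (φ y + h y), fun z hz => sub_le_sub_left (hy hz) _⟩

theorem terminates (hx₀ : x₀ ∈ X) (hinit : ∀ t, init t ∈ X) (hε : 0 < ε) :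
    ippmTerminates X h φ x₀ ρ L ε init := by
  obtain ⟨Δ, hΔ⟩ := W.exists_gap_bound x₀ ⟨x₀, hx₀⟩
  exact ⟨(W.ippmStop_bound hx₀ hinit hε hΔ).1, fun t _ =>
    (W.compositeModel _).apgStopSet_nonempty (hinit t) (by linarith)⟩

theorem ippmOut_mem (hx₀ : x₀ ∈ X) (hinit : ∀ t, init t ∈ X) :
    ippmOut X h φ x₀ ρ L ε init ∈ X :=
  W.ippmIter_mem hx₀ hinit _

/-- The output of iPPM is approximately stationary. -/
theorem ippmOut_residual (hx₀ : x₀ ∈ X) (hinit : ∀ t, init t ∈ X) (hε : 0 < ε) :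
    ∃ s ∈ subdiff X h (ippmOut X h φ x₀ ρ L ε init),
      ‖s + gradient φ (ippmOut X h φ x₀ ρ L ε init)‖ ≤ ε := by
  have hρ := W.ρ_pos
  obtain ⟨t, ht, hsmall⟩ := Nat.sInf_mem (W.terminates hx₀ hinit hε).1
  have e : ippmOut X h φ x₀ ρ L ε init = ippmIter X h φ x₀ ρ L ε init (t + 1) := by
    rw [← ht]
    rfl
  obtain ⟨s, hs, hres⟩ := W.ippmIter_residual (x₀ := x₀) hinit hε t
  rw [e]
  refine ⟨s, hs, ?_⟩
  set x := ippmIter X h φ x₀ ρ L ε init t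
  set x' := ippmIter X h φ x₀ ρ L ε init (t + 1)
  have e2 : s + gradient φ x' =
      (s + (gradient φ x' + (2 * ρ) • (x' - x))) - (2 * ρ) • (x' - x) := by abel
  rw [e2]
  refine (norm_sub_le _ _).trans ?_
  rw [norm_smul, Real.norm_eq_abs, abs_of_pos (by positivity)]
  linarith

theorem ippmCost_le (hx₀ : x₀ ∈ X) (hinit : ∀ t, init t ∈ X) (hε : 0 < ε) {Δ D Λ : ℝ}
    (hΔ : ∀ z ∈ X, φ x₀ + h x₀ - (φ z + h z) ≤ Δ) (hD : ∀ a ∈ X, ∀ b ∈ X, ‖a - b‖ ≤ D)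
    (hΛ : 0 ≤ Λ) (h1 : 128 * (L + 2 * ρ) ^ 3 * D ^ 2 ≤ (ε / 4) ^ 2 * ρ * Real.exp Λ) :
    (ippmCost X h φ x₀ ρ L ε init : ℝ) ≤
      (64 * ρ * Δ / ε ^ 2 + 1) * (Real.sqrt ((L + 2 * ρ) / ρ) * Λ + 3) := by
  have hb : ∀ t ∈ Finset.range (ippmIters X h φ x₀ ρ L ε init),
      (ippmApgIters X h φ x₀ ρ L ε init t : ℝ) ≤ Real.sqrt ((L + 2 * ρ) / ρ) * Λ + 3 :=
    fun t _ => (W.compositeModel _).apgIters_le (hinit t) hD (by linarith) hΛ h1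
  unfold ippmCost
  push_cast
  refine (Finset.sum_le_sum hb).trans ?_
  rw [Finset.sum_const, Finset.card_range, nsmul_eq_mul]
  gcongr
  exact (W.ippmStop_bound hx₀ hinit hε hΔ).2

end WeakModel

end IPPM

/-! ### Curvature and smoothness of the augmented Lagrangian. -/

namespace Setup

variable {n l : ℕ} {P : Setup n l}

theorem augLag_eq_sum (b : ℝ) (y : Vec l) (x : Vec n) :
    P.augLag b y x = P.g x + ∑ j, (y j * P.c x j + b / 2 * P.c x j ^ 2) := by
  unfold augLag
  rw [EuclideanSpace.norm_sq_eq, PiLp.inner_apply, Finset.sum_add_distrib, Finset.mul_sum,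
    add_assoc]
  simp [mul_comm]

theorem jacT_add (x : Vec n) (y y' : Vec l) : P.jacT x (y + y') = P.jacT x y + P.jacT x y' := by
  simp [jacT, add_smul, Finset.sum_add_distrib]

theorem jacT_smul (x : Vec n) (a : ℝ) (y : Vec l) : P.jacT x (a • y) = a • P.jacT x y := by
  simp [jacT, Finset.smul_sum, smul_smul]

theorem Lbar_nonneg : 0 ≤ P.Lbar := Real.sqrt_nonneg _

theorem sum_abs_mul_L_le (y : Vec l) : ∑ j, |y j| * P.L j ≤ P.Lbar * ‖y‖ := by
  refine (Real.sum_mul_le_sqrt_mul_sqrt _ _ _).trans (le_of_eq ?_)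
  rw [Lbar, EuclideanSpace.norm_eq, mul_comm]
  simp

theorem sum_abs_mul_L_add_le (b : ℝ) (a : Fin l → ℝ) (y : Vec l) :
    ∑ j, (|y j| * P.L j + b * a j) ≤ P.Lbar * ‖y‖ + b * ∑ j, a j := by
  rw [Finset.sum_add_distrib, ← Finset.mul_sum]
  exact add_le_add_left (sum_abs_mul_L_le y) _

namespace Admissible

variable (hP : P.Admissible)

include hP

theorem B_nonneg (j : Fin l) : 0 ≤ P.B j :=
  (abs_nonneg _).trans (hP.B_bound j _ hP.x₀_mem _ hP.x₀_mem).1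

theorem abs_c_le (j : Fin l) {x : Vec n} (hx : x ∈ extrap P.X) : |P.c x j| ≤ P.B j := by
  obtain ⟨a, ha, b, hb, rfl⟩ := hx
  exact (hP.B_bound j a ha b hb).1

theorem norm_gradC_le (j : Fin l) {x : Vec n} (hx : x ∈ extrap P.X) : ‖P.gradC j x‖ ≤ P.B j := by
  obtain ⟨a, ha, b, hb, rfl⟩ := hx
  exact (hP.B_bound j a ha b hb).2

theorem abs_c_sub_le (j : Fin l) {x z : Vec n} (hx : x ∈ extrap P.X) (hz : z ∈ extrap P.X) :
    |P.c z j - P.c x j| ≤ P.B j * ‖z - x‖ := by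
  have := (extrap_convex hP.h_convex.1).norm_image_sub_le_of_norm_fderiv_le (𝕜 := ℝ)
    (f := fun x => P.c x j) (fun w _ => (hP.c_smooth j).1 w) (C := P.B j) (fun w hw => ?_) hx hz
  · exact this
  · rw [← toDual_gradient, LinearIsometryEquiv.norm_map]
    exact hP.norm_gradC_le j hw

theorem β_pos (k : ℕ) : 0 < P.β k := mul_pos hP.β₀_pos (pow_pos (one_pos.trans hP.one_lt_σ) k)

theorem ρc_nonneg : 0 ≤ P.ρc :=
  Finset.sum_nonneg fun j _ => mul_nonneg (hP.B_nonneg j) (hP.ρ_nonneg j)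

theorem Lc_nonneg : 0 ≤ P.Lc :=
  Finset.sum_nonneg fun j _ => by
    have := hP.B_nonneg j
    have := hP.L_nonneg j
    positivity

theorem hasGradientAt_augLag (b : ℝ) (y : Vec l) (x : Vec n) :
    HasGradientAt (P.augLag b y) (gradient P.g x + P.jacT x (y + b • P.c x)) x := by
  have e : P.augLag b y = fun x => P.g x + ∑ j, (y j * P.c x j + b / 2 * P.c x j ^ 2) :=
    funext (augLag_eq_sum b y)
  rw [e, hasGradientAt_iff_hasFDerivAt, map_add]
  refine (hP.g_smooth.1 x).hasGradientAt.hasFDerivAt.add ?_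
  rw [jacT, map_sum]
  refine HasFDerivAt.fun_sum fun j _ => ?_
  have hc : HasFDerivAt (fun z => P.c z j)
      ((InnerProductSpace.toDual ℝ (Vec n)) (P.gradC j x)) x :=
    ((hP.c_smooth j).1 x).hasGradientAt.hasFDerivAt
  refine ((hc.const_mul (y j)).add ((hc.pow 2).const_mul (b / 2))).congr_fderiv ?_
  ext v
  simp
  ring

theorem gradient_augLag (b : ℝ) (y : Vec l) (x : Vec n) :
    gradient (P.augLag b y) x = gradient P.g x + P.jacT x (y + b • P.c x) :=
  (hP.hasGradientAt_augLag b y x).gradient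

theorem differentiable_augLag (b : ℝ) (y : Vec l) : Differentiable ℝ (P.augLag b y) :=
  fun x => (hP.hasGradientAt_augLag b y x).differentiableAt

theorem abs_c_linear_le_L (j : Fin l) (x z : Vec n) :
    |P.c z j - P.c x j - ⟪P.gradC j x, z - x⟫_ℝ| ≤ P.L j / 2 * ‖z - x‖ ^ 2 :=
  (hP.c_smooth j).abs_sub_linear_le x z

theorem abs_c_linear_le_ρ (j : Fin l) (x z : Vec n) :
    |P.c z j - P.c x j - ⟪P.gradC j x, z - x⟫_ℝ| ≤ P.ρ j / 2 * ‖z - x‖ ^ 2 := by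
  have h1 : P.c x j + ⟪P.gradC j x, z - x⟫_ℝ - P.ρ j / 2 * ‖z - x‖ ^ 2 ≤ P.c z j :=
    (hP.c_weak j).le_of_differentiable (hP.c_smooth j).1 x z
  have h2 := (hP.neg_c_weak j).le_of_differentiable (hP.c_smooth j).1.fun_neg x z
  have e : gradient (fun x => -P.c x j) x = -P.gradC j x := by
    refine HasGradientAt.gradient ?_
    rw [hasGradientAt_iff_hasFDerivAt, map_neg]
    exact ((hP.c_smooth j).1 x).hasGradientAt.hasFDerivAt.fun_neg
  rw [e, inner_neg_left] at h2
  rw [abs_le]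
  constructor <;> linarith

theorem augLag_lower {b : ℝ} (hb : 0 ≤ b) (y : Vec l) {x : Vec n} (hx : x ∈ extrap P.X)
    (z : Vec n) :
    P.augLag b y x + ⟪gradient (P.augLag b y) x, z - x⟫_ℝ
      - (P.ρ₀ + P.Lbar * ‖y‖ + b * P.ρc) / 2 * ‖z - x‖ ^ 2 ≤ P.augLag b y z := by
  rw [hP.gradient_augLag, augLag_eq_sum, augLag_eq_sum, inner_add_left, jacT, sum_inner]
  have hg := hP.g_weak.le_of_differentiable hP.g_smooth.1 x z
  have hj : ∀ j ∈ Finset.univ, (y j * P.c x j + b / 2 * P.c x j ^ 2)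
      + ⟪(y + b • P.c x) j • P.gradC j x, z - x⟫_ℝ
      - (|y j| * P.L j + b * (P.B j * P.ρ j)) * (‖z - x‖ ^ 2 / 2)
      ≤ y j * P.c z j + b / 2 * P.c z j ^ 2 := by
    intro j _
    have h1 := hP.abs_c_linear_le_L j x z
    have h2 := hP.abs_c_linear_le_ρ j x z
    have h3 := hP.abs_c_le j hx
    have hB := hP.B_nonneg j
    have h4 := hP.ρ_nonneg j
    rw [real_inner_smul_left]
    simp only [PiLp.add_apply, PiLp.smul_apply, smul_eq_mul]
    set r := P.c z j - P.c x j - ⟪P.gradC j x, z - x⟫_ℝ with hr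
    have h5 : -(|y j| * (P.L j / 2 * ‖z - x‖ ^ 2)) ≤ y j * r := by
      refine neg_le_of_abs_le ?_
      rw [abs_mul]
      gcongr
    have h6 : -(P.B j * (P.ρ j / 2 * ‖z - x‖ ^ 2)) ≤ P.c x j * r := by
      refine neg_le_of_abs_le ?_
      rw [abs_mul]
      gcongr
    have h7 := mul_le_mul_of_nonneg_left h6 hb
    -- In c(z)²/2 = c(x)²/2 + c(x)(c(z) - c(x)) + (c(z) - c(x))²/2 the last term is dropped. Only
    -- c(x)r can be negative; as c(x) has no fixed sign, weak convexity of both c_j and -c_j is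
    -- needed.
    have h8 : 0 ≤ b / 2 * (P.c z j - P.c x j) ^ 2 := by positivity
    have e : P.c z j = P.c x j + ⟪P.gradC j x, z - x⟫_ℝ + r := by rw [hr]; ring
    nlinarith
  have hs := Finset.sum_le_sum hj
  rw [Finset.sum_sub_distrib, Finset.sum_add_distrib, ← Finset.sum_mul] at hs
  have hy := mul_le_mul_of_nonneg_right
    (sum_abs_mul_L_add_le (P := P) b (fun j => P.B j * P.ρ j) y)
    (show 0 ≤ ‖z - x‖ ^ 2 / 2 by positivity)
  unfold ρc
  linarith

theorem augLag_upper {b : ℝ} (hb : 0 ≤ b) (y : Vec l) {x z : Vec n} (hx : x ∈ extrap P.X)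
    (hz : z ∈ extrap P.X) :
    P.augLag b y z ≤ P.augLag b y x + ⟪gradient (P.augLag b y) x, z - x⟫_ℝ
      + (P.L₀ + P.Lbar * ‖y‖ + b * P.Lc) / 2 * ‖z - x‖ ^ 2 := by
  rw [hP.gradient_augLag, augLag_eq_sum, augLag_eq_sum, inner_add_left, jacT, sum_inner]
  have hg := le_of_abs_le (hP.g_smooth.abs_sub_linear_le x z)
  have hj : ∀ j ∈ Finset.univ, y j * P.c z j + b / 2 * P.c z j ^ 2
      - (y j * P.c x j + b / 2 * P.c x j ^ 2)
      - ⟪(y + b • P.c x) j • P.gradC j x, z - x⟫_ℝ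
      ≤ (|y j| * P.L j + b * (P.B j * P.L j + P.B j ^ 2)) * (‖z - x‖ ^ 2 / 2) := by
    intro j _
    have h1 := hP.abs_c_linear_le_L j x z
    have h3 := hP.abs_c_le j hx
    have hB := hP.B_nonneg j
    have h4 := hP.L_nonneg j
    have h8 := sq_le_sq' (neg_le_of_abs_le (hP.abs_c_sub_le j hx hz))
      (le_of_abs_le (hP.abs_c_sub_le j hx hz))
    rw [real_inner_smul_left]
    simp only [PiLp.add_apply, PiLp.smul_apply, smul_eq_mul]
    set r := P.c z j - P.c x j - ⟪P.gradC j x, z - x⟫_ℝ with hr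
    have h5 : y j * r ≤ |y j| * (P.L j / 2 * ‖z - x‖ ^ 2) := by
      refine le_of_abs_le ?_
      rw [abs_mul]
      gcongr
    have h6 : P.c x j * r ≤ P.B j * (P.L j / 2 * ‖z - x‖ ^ 2) := by
      refine le_of_abs_le ?_
      rw [abs_mul]
      gcongr
    have h7 := mul_le_mul_of_nonneg_left h6 hb
    have h9 := mul_le_mul_of_nonneg_left h8 hb
    have e : P.c z j = P.c x j + ⟪P.gradC j x, z - x⟫_ℝ + r := by rw [hr]; ring
    nlinarith
  have hs := Finset.sum_le_sum hj
  rw [Finset.sum_sub_distrib, Finset.sum_sub_distrib, ← Finset.sum_mul] at hs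
  have hy := mul_le_mul_of_nonneg_right
    (sum_abs_mul_L_add_le (P := P) b (fun j => P.B j * P.L j + P.B j ^ 2) y)
    (show 0 ≤ ‖z - x‖ ^ 2 / 2 by positivity)
  unfold Lc
  linarith

theorem augLag_lip {b : ℝ} (hb : 0 ≤ b) (y : Vec l) {x z : Vec n} (hx : x ∈ extrap P.X)
    (hz : z ∈ extrap P.X) :
    ‖gradient (P.augLag b y) z - gradient (P.augLag b y) x‖ ≤
      (P.L₀ + P.Lbar * ‖y‖ + b * P.Lc) * ‖z - x‖ := by
  rw [hP.gradient_augLag, hP.gradient_augLag, add_sub_add_comm, jacT, jacT,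
    ← Finset.sum_sub_distrib]
  have hg := hP.g_smooth.2 z x
  have hj : ∀ j ∈ Finset.univ, ‖(y + b • P.c z) j • P.gradC j z - (y + b • P.c x) j • P.gradC j x‖
      ≤ (|y j| * P.L j + b * (P.B j * P.L j + P.B j ^ 2)) * ‖z - x‖ := by
    intro j _
    have h1 : ‖P.gradC j z - P.gradC j x‖ ≤ P.L j * ‖z - x‖ := (hP.c_smooth j).2 z x
    have h2 := hP.abs_c_sub_le j hx hz
    have h3 := hP.abs_c_le j hz
    have h4 := hP.norm_gradC_le j hx
    have h5 := hP.B_nonneg j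
    simp only [PiLp.add_apply, PiLp.smul_apply, smul_eq_mul]
    have e : (y j + b * P.c z j) • P.gradC j z - (y j + b * P.c x j) • P.gradC j x =
      y j • (P.gradC j z - P.gradC j x) + b • (P.c z j • (P.gradC j z - P.gradC j x)
        + (P.c z j - P.c x j) • P.gradC j x) := by module
    rw [e]
    refine (norm_add_le _ _).trans ?_
    rw [norm_smul, norm_smul, Real.norm_eq_abs, Real.norm_eq_abs, abs_of_nonneg hb]
    have h6 : ‖P.c z j • (P.gradC j z - P.gradC j x) + (P.c z j - P.c x j) • P.gradC j x‖ ≤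
        P.B j * (P.L j * ‖z - x‖) + (P.B j * ‖z - x‖) * P.B j := by
      refine (norm_add_le _ _).trans ?_
      rw [norm_smul, norm_smul, Real.norm_eq_abs, Real.norm_eq_abs]
      gcongr
    have h7 := mul_le_mul_of_nonneg_left h6 hb
    have h8 := mul_le_mul_of_nonneg_left h1 (abs_nonneg (y j))
    linarith
  have hs := (norm_sum_le _ _).trans (Finset.sum_le_sum hj)
  rw [← Finset.sum_mul, Finset.sum_add_distrib, ← Finset.mul_sum] at hs
  change _ ≤ (_ + b * P.Lc) * _ at hs
  have hy := mul_le_mul_of_nonneg_right (sum_abs_mul_L_le (P := P) y) (norm_nonneg (z - x))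
  refine (norm_add_le _ _).trans ?_
  linarith

/-- A lower bound independent of k and y, needed because ρ̂_k appears in a denominator in the APG
count. -/
theorem ρhat_lower (k : ℕ) (y : Vec l) : min 1 P.β₀ * (P.ρ₀ + P.ρc) ≤ P.ρhat k y := by
  have h1 := hP.ρ₀_nonneg
  have h2 := hP.ρc_nonneg
  have h3 : P.β₀ ≤ P.β k := le_mul_of_one_le_right hP.β₀_pos.le (one_le_pow₀ hP.one_lt_σ.le)
  have h4 : min 1 P.β₀ * P.ρ₀ ≤ 1 * P.ρ₀ := by gcongr; exact min_le_left _ _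
  have h5 : min 1 P.β₀ * P.ρc ≤ P.β k * P.ρc := by
    gcongr
    exact (min_le_right _ _).trans h3
  have h6 : 0 ≤ P.Lbar * ‖y‖ := mul_nonneg Lbar_nonneg (norm_nonneg _)
  unfold ρhat
  linarith

theorem ρlow_pos : 0 < min 1 P.β₀ * (P.ρ₀ + P.ρc) :=
  mul_pos (lt_min one_pos hP.β₀_pos) hP.ρ_pos

theorem weakModel (k : ℕ) (y : Vec l) :
    WeakModel P.X P.h (P.augLag (P.β k) y) (P.ρhat k y) (P.Lhat k y) where
  compact := hP.X_compact
  convex := hP.h_convex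
  lsc := hP.h_closed
  diff := hP.differentiable_augLag _ _
  ρ_pos := hP.ρlow_pos.trans_le (hP.ρhat_lower k y)
  L_nonneg := by
    have h1 := hP.L₀_nonneg
    have h2 := mul_nonneg (hP.β_pos k).le hP.Lc_nonneg
    have h3 : 0 ≤ P.Lbar * ‖y‖ := mul_nonneg Lbar_nonneg (norm_nonneg _)
    unfold Lhat
    linarith
  lower _ hx z _ := hP.augLag_lower (hP.β_pos k).le y hx z
  upper _ hx _ hz := hP.augLag_upper (hP.β_pos k).le y hx (subset_extrap hz)
  lip _ hx _ hz := hP.augLag_lip (hP.β_pos k).le y hx (subset_extrap hz)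

end Admissible

/-! ### Bounds along a regular run: feasibility, multipliers, objective gap. -/

theorem norm_le_sum_abs (y : Vec l) : ‖y‖ ≤ ∑ j, |y j| := by
  refine le_of_sq_le_sq ?_ (Finset.sum_nonneg fun j _ => abs_nonneg _)
  rw [EuclideanSpace.norm_sq_eq]
  exact Finset.sum_sq_le_sq_sum_of_nonneg fun j _ => abs_nonneg _

theorem state_succ_snd (ε : ℝ) (init : ℕ → ℕ → Vec n) (k : ℕ) :
    (P.state ε init (k + 1)).2 = (P.state ε init k).2 +
      P.dualStep k (P.state ε init (k + 1)).1 • P.c (P.state ε init (k + 1)).1 := rfl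

theorem γ_nonneg (k : ℕ) : 0 ≤ P.γ k := by
  unfold γ
  positivity

theorem γ_le (k : ℕ) : P.γ k ≤ ‖P.c P.x₀‖ := by
  unfold γ
  have h2 : 0 < Real.log 2 := Real.log_pos (by norm_num)
  have hle : Real.log 2 ≤ Real.log (k + 2) :=
    Real.log_le_log (by norm_num) (by linarith [Nat.cast_nonneg (α := ℝ) k])
  have h3 : Real.log 2 ^ 2 ≤ (k + 1) * Real.log (k + 2) ^ 2 := by
    have h4 : Real.log 2 ^ 2 ≤ Real.log (k + 2) ^ 2 := pow_le_pow_left₀ h2.le hle 2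
    have h5 : (0 : ℝ) ≤ k * Real.log (k + 2) ^ 2 := by positivity
    linarith
  have hpos : 0 < Real.log 2 ^ 2 := by positivity
  rw [div_le_iff₀ (hpos.trans_le h3), mul_comm]
  gcongr

namespace Admissible

variable (hP : P.Admissible)

include hP

theorem sum_B_nonneg : 0 ≤ ∑ j, P.B j := Finset.sum_nonneg fun j _ => hP.B_nonneg j

theorem norm_c_le {x : Vec n} (hx : x ∈ P.X) : ‖P.c x‖ ≤ ∑ j, P.B j :=
  (norm_le_sum_abs _).trans (Finset.sum_le_sum fun j _ => hP.abs_c_le j (subset_extrap hx))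

theorem norm_jacT_le {x : Vec n} (hx : x ∈ P.X) (y : Vec l) :
    ‖P.jacT x y‖ ≤ (∑ j, P.B j) * ‖y‖ := by
  rw [Finset.sum_mul]
  refine (norm_sum_le _ _).trans (Finset.sum_le_sum fun j _ => ?_)
  rw [norm_smul, mul_comm]
  have := hP.B_nonneg j
  gcongr
  · exact hP.norm_gradC_le j (subset_extrap hx)
  · exact PiLp.norm_apply_le y j

theorem exists_diam : ∃ D, 0 < D ∧ ∀ a ∈ P.X, ∀ b ∈ P.X, ‖a - b‖ ≤ D := by
  obtain ⟨D, hD⟩ := Metric.isBounded_iff.1 hP.X_compact.isBounded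
  refine ⟨max D 1, by positivity, fun a ha b hb => ?_⟩
  rw [← dist_eq_norm]
  exact (hD ha hb).trans (le_max_left _ _)

theorem exists_grad_bound : ∃ G, 0 ≤ G ∧ ∀ x ∈ P.X, ‖gradient P.g x‖ ≤ G := by
  obtain ⟨D, hD0, hD⟩ := hP.exists_diam
  have hL := hP.L₀_nonneg
  refine ⟨‖gradient P.g P.x₀‖ + P.L₀ * D, by positivity, fun x hx => ?_⟩
  have h1 := hP.g_smooth.2 x P.x₀
  have h2 : P.L₀ * ‖x - P.x₀‖ ≤ P.L₀ * D := by
    gcongr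
    exact hD x hx _ hP.x₀_mem
  have h3 := norm_sub_norm_le (gradient P.g x) (gradient P.g P.x₀)
  linarith

theorem exists_g_bound : ∃ G, 0 ≤ G ∧ ∀ x ∈ P.X, |P.g x| ≤ G := by
  obtain ⟨G, hG⟩ := hP.X_compact.exists_bound_of_continuousOn
    hP.g_smooth.1.continuous.continuousOn
  exact ⟨G, (norm_nonneg _).trans (hG _ hP.x₀_mem), hG⟩

theorem exists_h_lower : ∃ m, ∀ x ∈ P.X, m ≤ P.h x := by
  obtain ⟨a, -, ha⟩ := LowerSemicontinuousOn.exists_isMinOn ⟨_, hP.x₀_mem⟩ hP.X_compact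
    hP.h_closed
  exact ⟨P.h a, fun x hx => ha hx⟩

theorem norm_dualStep_smul_le (k : ℕ) (x : Vec n) :
    ‖P.dualStep k x • P.c x‖ ≤ P.w₀ * ‖P.c x‖ ∧
      ‖P.dualStep k x • P.c x‖ ≤ P.w₀ * ‖P.c P.x₀‖ := by
  have hw := hP.w₀_pos
  have hγ := P.γ_nonneg k
  have hmin : 0 ≤ min 1 (P.γ k / ‖P.c x‖) := le_min zero_le_one (by positivity)
  rw [norm_smul, dualStep, Real.norm_eq_abs, abs_of_nonneg (mul_nonneg hw.le hmin), mul_assoc]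
  constructor
  · gcongr
    exact mul_le_of_le_one_left (norm_nonneg _) (min_le_left _ _)
  · gcongr
    rcases (norm_nonneg (P.c x)).eq_or_lt with h0 | h0
    · rw [← h0, mul_zero]
      positivity
    · refine (mul_le_mul_of_nonneg_right (min_le_right _ _) h0.le).trans ?_
      rw [div_mul_cancel₀ _ h0.ne']
      exact P.γ_le k

/-- Linear growth is crude but enough: it starts the bootstrap in `exists_dual_bound`, where the
geometric growth of β_k beats the factor k. -/
theorem norm_state_snd_le (ε : ℝ) (init : ℕ → ℕ → Vec n) (k : ℕ) :
    ‖(P.state ε init k).2‖ ≤ P.w₀ * ‖P.c P.x₀‖ * k := by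
  induction k with
  | zero => simp [state]
  | succ k ih =>
    rw [state_succ_snd]
    have := (hP.norm_dualStep_smul_le k (P.state ε init (k + 1)).1).2
    refine (norm_add_le _ _).trans ?_
    push_cast
    linarith

variable {ε : ℝ} {init : ℕ → ℕ → Vec n}

theorem state_fst_mem (hinit : ∀ k t, init k t ∈ P.X) (k : ℕ) :
    (P.state ε init k).1 ∈ P.X := by
  induction k with
  | zero => exact hP.x₀_mem
  | succ k ih => exact (hP.weakModel k _).ippmOut_mem ih (hinit k)

theorem terminates (hε : 0 < ε) (hinit : ∀ k t, init k t ∈ P.X) (k : ℕ) :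
    P.Terminates ε init k :=
  (hP.weakModel k _).terminates (hP.state_fst_mem hinit k) (hinit k) hε

theorem state_residual (hε : 0 < ε) (hinit : ∀ k t, init k t ∈ P.X) (k : ℕ) :
    ∃ s ∈ subdiff P.X P.h (P.state ε init (k + 1)).1,
      ‖s + (gradient P.g (P.state ε init (k + 1)).1 + P.jacT (P.state ε init (k + 1)).1
        ((P.state ε init k).2 + P.β k • P.c (P.state ε init (k + 1)).1))‖ ≤ ε := by
  have := (hP.weakModel k (P.state ε init k).2).ippmOut_residual
    (hP.state_fst_mem (ε := ε) hinit k) (hinit k) hε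
  rwa [hP.gradient_augLag] at this

theorem isKKT_state (hε : 0 < ε) (hinit : ∀ k t, init k t ∈ P.X) (k : ℕ)
    (hc : ‖P.c (P.state ε init (k + 1)).1‖ ≤ ε) : P.IsKKT ε (P.state ε init (k + 1)).1 := by
  obtain ⟨s, hs, hres⟩ := hP.state_residual hε hinit k
  refine ⟨(P.state ε init k).2 + P.β k • P.c (P.state ε init (k + 1)).1, hc,
    (Metric.infEDist_le_edist_of_mem (Set.mem_image_of_mem _ (Set.mem_image_of_mem _ hs))).trans ?_⟩
  rw [edist_comm, edist_dist, dist_zero_right, add_comm (gradient _ _) s, add_assoc]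
  exact ENNReal.ofReal_le_ofReal hres

theorem norm_c_state_le (hε : 0 < ε) (hε1 : ε ≤ 1) (hinit : ∀ k t, init k t ∈ P.X) {v G : ℝ}
    (hv : 0 < v) (hreg : P.Regular ε init v) (hG : ∀ x ∈ P.X, ‖gradient P.g x‖ ≤ G) (k : ℕ) :
    ‖P.c (P.state ε init (k + 1)).1‖ ≤
      (1 + G + (∑ j, P.B j) * ‖(P.state ε init k).2‖) / v / P.β k := by
  obtain ⟨s, hs, hres⟩ := hP.state_residual hε hinit k
  have hβ := hP.β_pos k
  have hX := hP.state_fst_mem (ε := ε) hinit (k + 1)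
  have h1 := (hreg k).trans (Metric.infEDist_le_edist_of_mem (Set.mem_image_of_mem _ hs))
  set x := (P.state ε init (k + 1)).1
  set y := (P.state ε init k).2
  rw [edist_dist, ENNReal.ofReal_le_ofReal_iff dist_nonneg, dist_eq_norm] at h1
  -- The penalty part of the augmented Lagrangian gradient is β_k J_cᵀ c, so dividing the residual
  -- by β_k isolates the quantity in the regularity condition.
  have e : -P.jacT x (P.c x) - (P.β k)⁻¹ • s = (P.β k)⁻¹ • ((gradient P.g x + P.jacT x y)
      - (s + (gradient P.g x + P.jacT x (y + P.β k • P.c x)))) := by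
    rw [jacT_add, jacT_smul]
    match_scalars <;> field_simp <;> ring
  rw [e, norm_smul, Real.norm_eq_abs, abs_of_pos (inv_pos.2 hβ)] at h1
  have h2 : ‖(gradient P.g x + P.jacT x y)
      - (s + (gradient P.g x + P.jacT x (y + P.β k • P.c x)))‖ ≤
      1 + G + (∑ j, P.B j) * ‖y‖ := by
    refine (norm_sub_le _ _).trans ?_
    have h3 := norm_add_le (gradient P.g x) (P.jacT x y)
    have h4 := hP.norm_jacT_le hX y
    have h5 := hG x hX
    linarith
  have h3 := mul_le_mul_of_nonneg_left h2 (inv_pos.2 hβ).le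
  rw [div_div, le_div_iff₀ (by positivity)]
  have h4 := mul_le_mul_of_nonneg_right (h1.trans h3) hβ.le
  rw [inv_mul_eq_div, div_mul_cancel₀ _ hβ.ne'] at h4
  linarith

theorem exists_dual_bound {v : ℝ} (hv : 0 < v) :
    ∃ Y, 0 ≤ Y ∧ ∀ ε : ℝ, 0 < ε → ε ≤ 1 → ∀ init : ℕ → ℕ → Vec n, (∀ k t, init k t ∈ P.X) →
      P.Regular ε init v → ∀ k, ‖(P.state ε init k).2‖ ≤ Y := by
  obtain ⟨G, hG0, hG⟩ := hP.exists_grad_bound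
  have hB := hP.sum_B_nonneg
  have hw := hP.w₀_pos
  have hβ₀ := hP.β₀_pos
  have hσ := hP.one_lt_σ
  have hσ0 : 0 < P.σ := one_pos.trans hσ
  set b := (∑ j, P.B j) * (P.w₀ * ‖P.c P.x₀‖) with hb
  set a : ℕ → ℝ := fun k => P.w₀ / (v * P.β₀) * ((1 + G) * P.σ⁻¹ ^ k + b * (k * P.σ⁻¹ ^ k))
    with ha
  have hr : ‖P.σ⁻¹‖ < 1 := by
    rw [norm_inv, Real.norm_eq_abs, abs_of_pos hσ0]
    exact inv_lt_one_of_one_lt₀ hσ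
  have hsum : Summable a := by
    refine Summable.mul_left _ (Summable.add ?_ ?_)
    · exact (summable_geometric_of_norm_lt_one hr).mul_left _
    · simpa using (summable_pow_mul_geometric_of_norm_lt_one 1 hr).mul_left b
  have ha0 : ∀ k, 0 ≤ a k := fun k => by positivity
  refine ⟨∑' k, a k, tsum_nonneg ha0, fun ε hε hε1 init hinit hreg k => ?_⟩
  refine le_trans ?_ (hsum.sum_le_tsum (Finset.range k) fun i _ => ha0 i)
  induction k with
  | zero => simp [state]
  | succ k ih =>
    rw [Finset.sum_range_succ, state_succ_snd]
    refine (norm_add_le _ _).trans (add_le_add ih ?_)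
    refine (hP.norm_dualStep_smul_le k _).1.trans ?_
    have h1 := hP.norm_c_state_le hε hε1 hinit hv hreg hG k
    have h2 := hP.norm_state_snd_le ε init k
    have hβ := hP.β_pos k
    have h3 : ‖P.c (P.state ε init (k + 1)).1‖ ≤ (1 + G + b * k) / v / P.β k := by
      refine h1.trans ?_
      rw [hb, mul_assoc]
      gcongr
    refine (mul_le_mul_of_nonneg_left h3 hw.le).trans (le_of_eq ?_)
    simp only [ha, β]
    rw [inv_pow]
    field_simp

/-- Uniform bounds along all runs that satisfy the regularity condition. -/
theorem exists_run_bounds {v : ℝ} (hv : 0 < v) :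
    ∃ Y M Δ : ℝ, 0 ≤ Y ∧ 0 < M ∧ 0 ≤ Δ ∧ ∀ ε : ℝ, 0 < ε → ε ≤ 1 → ∀ init : ℕ → ℕ → Vec n,
      (∀ k t, init k t ∈ P.X) → P.Regular ε init v → ∀ k,
        ‖(P.state ε init k).2‖ ≤ Y ∧ ‖P.c (P.state ε init (k + 1)).1‖ ≤ M / P.β k ∧
        ∀ z ∈ P.X, P.augLag (P.β k) (P.state ε init k).2 (P.state ε init k).1
          + P.h (P.state ε init k).1
          - (P.augLag (P.β k) (P.state ε init k).2 z + P.h z) ≤ Δ := by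
  obtain ⟨Y, hY0, hY⟩ := hP.exists_dual_bound hv
  obtain ⟨G, hG0, hG⟩ := hP.exists_grad_bound
  obtain ⟨D, hD0, hD⟩ := hP.exists_diam
  obtain ⟨g, hg0, hg⟩ := hP.exists_g_bound
  obtain ⟨m, hm⟩ := hP.exists_h_lower
  have hB := hP.sum_B_nonneg
  have hβ₀ := hP.β₀_pos
  have hσ := hP.one_lt_σ
  set S := ∑ j, P.B j
  set N := 1 + G + S * Y with hN
  have hN0 : 0 < N := by positivity
  -- `h` need not be bounded above on X; along the run it is, by the subgradient inequality tested
  -- at x⁰ with a subgradient of norm at most N + S(N/v).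
  set H := P.h P.x₀ + (N + S * (N / v)) * D with hH
  have hgap : ∀ ε : ℝ, 0 < ε → ε ≤ 1 → ∀ init : ℕ → ℕ → Vec n,
      (∀ k t, init k t ∈ P.X) → P.Regular ε init v → ∀ k,
        P.h (P.state ε init k).1 ≤ H ∧
        P.β k / 2 * ‖P.c (P.state ε init k).1‖ ^ 2 ≤
          P.β₀ / 2 * S ^ 2 + P.σ * (N / v) ^ 2 / (2 * P.β₀) := by
    intro ε hε hε1 init hinit hreg k
    -- Regularity says nothing about x⁰, which is bounded by compactness. Later, the penalty at the
    -- warm start is σβ_k/2 · (N/(vβ_k))², which decreases with β_k.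
    cases k with
    | zero =>
      have hc := hP.norm_c_le hP.x₀_mem
      have e : P.β 0 = P.β₀ := by simp [β]
      constructor
      · change P.h P.x₀ ≤ H
        have : 0 ≤ (N + S * (N / v)) * D := by positivity
        linarith
      · change P.β 0 / 2 * ‖P.c P.x₀‖ ^ 2 ≤ _
        rw [e]
        have h1 : P.β₀ / 2 * ‖P.c P.x₀‖ ^ 2 ≤ P.β₀ / 2 * S ^ 2 := by gcongr
        have h2 : 0 ≤ P.σ * (N / v) ^ 2 / (2 * P.β₀) := by positivity
        linarith
    | succ k =>
      have hβ := hP.β_pos k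
      have hX := hP.state_fst_mem (ε := ε) hinit (k + 1)
      have hy := hY ε hε hε1 init hinit hreg k
      have hc : ‖P.c (P.state ε init (k + 1)).1‖ ≤ N / v / P.β k := by
        refine (hP.norm_c_state_le hε hε1 hinit hv hreg hG k).trans ?_
        gcongr
        exact add_le_add le_rfl (mul_le_mul_of_nonneg_left hy hB)
      obtain ⟨s, hs, hres⟩ := hP.state_residual hε hinit k
      set x := (P.state ε init (k + 1)).1
      set y := (P.state ε init k).2
      constructor
      · have h1 := hs.2 _ hP.x₀_mem
        have h2 := neg_le_of_abs_le (abs_real_inner_le_norm s (P.x₀ - x))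
        have h3 : ‖s‖ ≤ N + S * (N / v) := by
          have e : s = (s + (gradient P.g x + P.jacT x (y + P.β k • P.c x)))
              - (gradient P.g x + P.jacT x (y + P.β k • P.c x)) := by abel
          have h4 := hP.norm_jacT_le hX (y + P.β k • P.c x)
          have h5 : ‖y + P.β k • P.c x‖ ≤ Y + N / v := by
            refine (norm_add_le _ _).trans (add_le_add hy ?_)
            rw [norm_smul, Real.norm_eq_abs, abs_of_pos hβ, mul_comm, ← le_div_iff₀ hβ]
            exact hc
          have h6 := mul_le_mul_of_nonneg_left h5 hB
          have h7 := norm_add_le (gradient P.g x) (P.jacT x (y + P.β k • P.c x))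
          have h8 := hG x hX
          rw [e]
          refine (norm_sub_le _ _).trans ?_
          linarith
        have h4 : ‖s‖ * ‖P.x₀ - x‖ ≤ (N + S * (N / v)) * D := by
          gcongr
          exact hD _ hP.x₀_mem _ hX
        linarith
      · have e : P.β (k + 1) = P.σ * P.β k := by
          simp only [β, pow_succ]
          ring
        have hle : P.β₀ ≤ P.β k := le_mul_of_one_le_right hβ₀.le (one_le_pow₀ hσ.le)
        have h1 : ‖P.c x‖ ^ 2 ≤ (N / v / P.β k) ^ 2 := pow_le_pow_left₀ (norm_nonneg _) hc 2
        have h2 : P.σ * P.β k / 2 * ‖P.c x‖ ^ 2 ≤ P.σ * P.β k / 2 * (N / v / P.β k) ^ 2 := by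
          have : 0 < P.σ := one_pos.trans hσ
          gcongr
        have h3 : P.σ * P.β k / 2 * (N / v / P.β k) ^ 2 = P.σ * (N / v) ^ 2 / (2 * P.β k) := by
          field_simp
        have h4 : P.σ * (N / v) ^ 2 / (2 * P.β k) ≤ P.σ * (N / v) ^ 2 / (2 * P.β₀) := by
          have : 0 < P.σ := one_pos.trans hσ
          gcongr
        have h5 : 0 ≤ P.β₀ / 2 * S ^ 2 := by positivity
        rw [e]
        linarith
  set Δ := 2 * g + 2 * (Y * S) + (P.β₀ / 2 * S ^ 2 + P.σ * (N / v) ^ 2 / (2 * P.β₀)) + (H - m)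
    with hΔ
  refine ⟨Y, N / v, max Δ 0, hY0, by positivity, le_max_right _ _,
    fun ε hε hε1 init hinit hreg k => ⟨hY ε hε hε1 init hinit hreg k, ?_, fun z hz => ?_⟩⟩
  · have hβ := hP.β_pos k
    have hy := hY ε hε hε1 init hinit hreg k
    refine (hP.norm_c_state_le hε hε1 hinit hv hreg hG k).trans ?_
    gcongr
    exact add_le_add le_rfl (mul_le_mul_of_nonneg_left hy hB)
  · refine le_trans ?_ (le_max_left _ _)
    obtain ⟨hh, hc⟩ := hgap ε hε hε1 init hinit hreg k
    have hX := hP.state_fst_mem (ε := ε) hinit k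
    have hy := hY ε hε hε1 init hinit hreg k
    set x := (P.state ε init k).1
    set y := (P.state ε init k).2
    have hin : ∀ w ∈ P.X, |⟪y, P.c w⟫_ℝ| ≤ Y * S := fun w hw =>
      (abs_real_inner_le_norm _ _).trans (by
        have := hP.norm_c_le hw
        gcongr)
    have h1 := abs_le.1 (hin x hX)
    have h2 := abs_le.1 (hin z hz)
    have h3 := abs_le.1 (hg x hX)
    have h4 := abs_le.1 (hg z hz)
    have h5 := hm z hz
    have h6 : 0 ≤ P.β k / 2 * ‖P.c z‖ ^ 2 := by
      have := hP.β_pos k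
      positivity
    unfold augLag
    linarith [h1.2, h2.1, h3.2, h4.1]

end Admissible

/-! ### Counting outer iterations and the total cost. -/

theorem one_le_one_add_log {ε : ℝ} (hε : 0 < ε) (hε1 : ε ≤ 1) : 1 ≤ 1 + Real.log (1 / ε) :=
  le_add_of_nonneg_right (Real.log_nonneg (by rwa [le_div_iff₀ hε, one_mul]))

namespace Admissible

variable (hP : P.Admissible)

include hP

theorem β_mono : Monotone P.β := fun _ _ hij =>
  mul_le_mul_of_nonneg_left (pow_le_pow_right₀ hP.one_lt_σ.le hij) hP.β₀_pos.le

/-- The penalty parameter reaches `M/ε` in `O(1 + log(1/ε))` steps, at a value `O(1/ε)`. -/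
theorem exists_outer_count {M : ℝ} (hM : 0 < M) :
    ∃ C₁ C₂ : ℝ, 0 < C₁ ∧ 0 < C₂ ∧ ∀ ε : ℝ, 0 < ε → ε ≤ 1 → ∃ k : ℕ, M / P.β k ≤ ε ∧
      P.β k ≤ C₁ / ε ∧ ((k + 1 : ℕ) : ℝ) ≤ C₂ * (1 + Real.log (1 / ε)) := by
  have hβ₀ := hP.β₀_pos
  have hσ := hP.one_lt_σ
  have hσ0 : 0 < P.σ := one_pos.trans hσ
  have hlog : 0 < Real.log P.σ := Real.log_pos hσ
  set C₁ := P.β₀ + P.σ * M with hC₁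
  have hC₁0 : 0 < C₁ := by positivity
  have hlogC : 0 ≤ Real.log (C₁ / P.β₀) := by
    apply Real.log_nonneg
    rw [le_div_iff₀ hβ₀]
    have : 0 < P.σ * M := by positivity
    linarith
  refine ⟨C₁, 1 + (Real.log (C₁ / P.β₀) + 1) / Real.log P.σ, hC₁0, by positivity,
    fun ε hε hε1 => ?_⟩
  have hex : ∃ k : ℕ, M / ε ≤ P.β k := by
    obtain ⟨k, hk⟩ := pow_unbounded_of_one_lt (M / ε / P.β₀) hσ
    refine ⟨k, ?_⟩
    rw [div_lt_iff₀ hβ₀] at hk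
    unfold β
    linarith
  classical
  have hk := Nat.find_spec hex
  have hlt : ∀ j < Nat.find hex, ¬ M / ε ≤ P.β j := fun j hj => Nat.find_min hex hj
  set k := Nat.find hex
  -- By minimality of k the penalty overshoots M/ε by at most the factor σ, unless k = 0.
  have hβk : P.β k ≤ C₁ / ε := by
    rw [le_div_iff₀ hε]
    rcases Nat.eq_zero_or_pos k with h0 | h0
    · have : P.β k * ε ≤ P.β₀ * 1 := by
        rw [h0]
        simp only [β, pow_zero, mul_one]
        exact mul_le_of_le_one_right hβ₀.le hε1
      have h2 : 0 < P.σ * M := by positivity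
      linarith
    · obtain ⟨j, hj⟩ := Nat.exists_eq_succ_of_ne_zero h0.ne'
      have h1 := not_le.1 (hlt j (by omega))
      rw [lt_div_iff₀ hε] at h1
      have h2 : P.β k = P.σ * P.β j := by
        rw [hj, Nat.succ_eq_add_one]
        simp only [β, pow_succ]
        ring
      have h3 := mul_le_mul_of_nonneg_left h1.le hσ0.le
      rw [h2]
      linarith
  refine ⟨k, ?_, hβk, ?_⟩
  · rw [div_le_iff₀ (hP.β_pos k)]
    rw [div_le_iff₀ hε] at hk
    linarith
  · have h1 : P.σ ^ k ≤ C₁ / P.β₀ * (1 / ε) := by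
      rw [div_mul_div_comm, mul_one, ← div_div, div_right_comm, le_div_iff₀ hβ₀, mul_comm]
      exact hβk
    have h2 := Real.log_le_log (by positivity) h1
    rw [Real.log_pow, Real.log_mul (by positivity) (by positivity)] at h2
    have h3 := one_le_one_add_log hε hε1
    have h4 : (k : ℝ) ≤ (Real.log (C₁ / P.β₀) + 1) / Real.log P.σ * (1 + Real.log (1 / ε)) := by
      rw [div_mul_eq_mul_div, le_div_iff₀ hlog]
      nlinarith
    push_cast
    linarith

/-- The cost of one outer iteration with `β_k = O(1/ε)` and `ρ̂_k = O(ε^{-e})`. -/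
theorem exists_cost_bound {Y Δ C₁ R e : ℝ} (hY : 0 ≤ Y) (hΔ : 0 ≤ Δ) (hC₁ : 0 < C₁) (hR : 0 < R)
    (he : e ≤ 1) :
    ∃ C₃ : ℝ, 0 < C₃ ∧ ∀ ε : ℝ, 0 < ε → ε ≤ 1 → ∀ init : ℕ → ℕ → Vec n,
      (∀ k t, init k t ∈ P.X) → ∀ k, ‖(P.state ε init k).2‖ ≤ Y → P.β k ≤ C₁ / ε →
      P.ρhat k (P.state ε init k).2 ≤ R * ε ^ (-e) →
      (∀ z ∈ P.X, P.augLag (P.β k) (P.state ε init k).2 (P.state ε init k).1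
          + P.h (P.state ε init k).1
          - (P.augLag (P.β k) (P.state ε init k).2 z + P.h z) ≤ Δ) →
      (P.cost ε init k : ℝ) ≤ C₃ * ε ^ (-((5 + e) / 2)) * (1 + Real.log (1 / ε)) := by
  obtain ⟨D, hD0, hD⟩ := hP.exists_diam
  have hρl := hP.ρlow_pos
  have hL₀ := hP.L₀_nonneg
  have hLb := P.Lbar_nonneg
  have hLc := hP.Lc_nonneg
  set r := min 1 P.β₀ * (P.ρ₀ + P.ρc) with hr
  set C₂ := P.L₀ + P.Lbar * Y + C₁ * P.Lc + 2 * R with hC₂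
  have hC₂0 : 0 < C₂ := by positivity
  set A := 1 + 2048 * C₂ ^ 3 * D ^ 2 / r with hA
  have hA1 : 1 ≤ A := le_add_of_nonneg_right (by positivity)
  have hlogA := Real.log_nonneg hA1
  refine ⟨(64 * Δ + 1 / r) * Real.sqrt (R * C₂) * (Real.log A + 8), by positivity,
    fun ε hε hε1 init hinit k hyk hβk hρk hgap => ?_⟩
  set y := (P.state ε init k).2
  have W := hP.weakModel k y
  have hρ := W.ρ_pos
  have hL := W.L_nonneg
  have hrρ : r ≤ P.ρhat k y := hP.ρhat_lower k y
  have hlog1 := one_le_one_add_log hε hε1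
  have hinv : 1 ≤ ε⁻¹ := (one_le_inv₀ hε).2 hε1
  have hepow : ε ^ (-e) ≤ ε⁻¹ := by
    rw [← Real.rpow_neg_one]
    exact Real.rpow_le_rpow_of_exponent_ge hε hε1 (by linarith)
  have hL' : P.Lhat k y + 2 * P.ρhat k y ≤ C₂ * ε⁻¹ := by
    have h1 : P.Lbar * ‖y‖ ≤ P.Lbar * Y := by gcongr
    have h2 : P.β k * P.Lc ≤ C₁ / ε * P.Lc := by gcongr
    have h3 : R * ε ^ (-e) ≤ R * ε⁻¹ := by gcongr
    have h4 : (P.L₀ + P.Lbar * Y) * 1 ≤ (P.L₀ + P.Lbar * Y) * ε⁻¹ := by gcongr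
    unfold Lhat
    rw [div_eq_mul_inv] at h2
    linarith
  set ρ := P.ρhat k y
  set L' := P.Lhat k y + 2 * ρ with hL'def
  have hL'0 : 0 < L' := by positivity
  -- The APG count needs exp Λ of order L'³/(ε²ρ); with L' = O(1/ε) and ρ ≥ r this is ε⁻⁵. The
  -- constant 2048 in A is 128 · 4², from the tolerance ε/4.
  have hexp : Real.exp (Real.log A + 5 * Real.log (1 / ε)) = A * ε⁻¹ ^ 5 := by
    rw [Real.exp_add, Real.exp_log (by linarith),
      show (5 : ℝ) * Real.log (1 / ε) = (5 : ℕ) * Real.log (1 / ε) by norm_num, Real.exp_nat_mul,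
      Real.exp_log (by positivity), one_div]
  have hΛ : 0 ≤ Real.log A + 5 * Real.log (1 / ε) := by linarith
  have hcond : 128 * L' ^ 3 * D ^ 2 ≤
      (ε / 4) ^ 2 * ρ * Real.exp (Real.log A + 5 * Real.log (1 / ε)) := by
    rw [hexp]
    have h1 : 128 * L' ^ 3 * D ^ 2 ≤ 128 * (C₂ * ε⁻¹) ^ 3 * D ^ 2 := by gcongr
    have h2 : 128 * (C₂ * ε⁻¹) ^ 3 * D ^ 2 =
        (ε / 4) ^ 2 * r * ((2048 * C₂ ^ 3 * D ^ 2 / r) * ε⁻¹ ^ 5) := by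
      field_simp
      norm_num
    refine h1.trans (h2.le.trans ?_)
    gcongr
    rw [hA]
    linarith
  have hcost := W.ippmCost_le (hP.state_fst_mem (ε := ε) hinit k) (hinit k) hε hgap hD hΛ hcond
  change (P.cost ε init k : ℝ) ≤ _ at hcost
  refine hcost.trans ?_
  have hsq1 : 1 ≤ Real.sqrt (L' / ρ) := by
    rw [Real.one_le_sqrt, le_div_iff₀ hρ]
    linarith
  have hin : Real.sqrt (L' / ρ) * (Real.log A + 5 * Real.log (1 / ε)) + 3 ≤
      Real.sqrt (L' / ρ) * ((Real.log A + 8) * (1 + Real.log (1 / ε))) := by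
    have h1 : Real.log A + 5 * Real.log (1 / ε) + 3 ≤
        (Real.log A + 8) * (1 + Real.log (1 / ε)) := by nlinarith
    have h2 := mul_le_mul_of_nonneg_left h1 (zero_le_one.trans hsq1)
    linarith
  have hout : 64 * ρ * Δ / ε ^ 2 + 1 ≤ (64 * Δ + 1 / r) * ε⁻¹ ^ 2 * ρ := by
    have h1 : 1 * 1 ≤ ε⁻¹ ^ 2 * (ρ / r) := by
      have : 1 ≤ ρ / r := by rwa [le_div_iff₀ hρl, one_mul]
      have h2 : 1 ≤ ε⁻¹ ^ 2 := one_le_pow₀ hinv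
      gcongr
    have h2 : (64 * Δ + 1 / r) * ε⁻¹ ^ 2 * ρ = 64 * ρ * Δ / ε ^ 2 + ε⁻¹ ^ 2 * (ρ / r) := by
      rw [inv_pow]
      ring
    linarith
  -- The number of proximal steps carries ρ and each APG call √(L'/ρ); they combine to √(ρL'), the
  -- source of the exponent.
  have hsqrt : ρ * Real.sqrt (L' / ρ) ≤ Real.sqrt (R * C₂) * ε ^ (-((1 + e) / 2)) := by
    have h1 : ρ * Real.sqrt (L' / ρ) = Real.sqrt (ρ * L') := by
      nth_rewrite 1 [← Real.sqrt_sq hρ.le]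
      rw [← Real.sqrt_mul (sq_nonneg ρ)]
      congr 1
      field_simp
    have h2 : ε ^ (-((1 + e) / 2)) = Real.sqrt (ε ^ (-e) * ε⁻¹) := by
      rw [← Real.rpow_neg_one, ← Real.rpow_add hε, Real.sqrt_eq_rpow, ← Real.rpow_mul hε.le]
      congr 1
      ring
    rw [h1, h2, ← Real.sqrt_mul (by positivity)]
    apply Real.sqrt_le_sqrt
    calc ρ * L' ≤ (R * ε ^ (-e)) * (C₂ * ε⁻¹) := by gcongr
      _ = R * C₂ * (ε ^ (-e) * ε⁻¹) := by ring
  have hpow : ε ^ (-((5 + e) / 2)) = ε⁻¹ ^ 2 * ε ^ (-((1 + e) / 2)) := by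
    have h1 : ε⁻¹ ^ 2 = ε ^ (-2 : ℝ) := by
      rw [Real.rpow_neg hε.le, inv_pow]
      norm_num
    rw [h1, ← Real.rpow_add hε]
    congr 1
    ring
  have hlam : 0 ≤ (Real.log A + 8) * (1 + Real.log (1 / ε)) := by
    apply mul_nonneg <;> linarith
  calc (64 * ρ * Δ / ε ^ 2 + 1) *
        (Real.sqrt (L' / ρ) * (Real.log A + 5 * Real.log (1 / ε)) + 3)
      ≤ ((64 * Δ + 1 / r) * ε⁻¹ ^ 2 * ρ) *
        (Real.sqrt (L' / ρ) * ((Real.log A + 8) * (1 + Real.log (1 / ε)))) := by gcongr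
    _ = (64 * Δ + 1 / r) * ε⁻¹ ^ 2 * (ρ * Real.sqrt (L' / ρ)) *
        ((Real.log A + 8) * (1 + Real.log (1 / ε))) := by ring
    _ ≤ (64 * Δ + 1 / r) * ε⁻¹ ^ 2 * (Real.sqrt (R * C₂) * ε ^ (-((1 + e) / 2))) *
        ((Real.log A + 8) * (1 + Real.log (1 / ε))) := by gcongr
    _ = _ := by
      rw [hpow]
      ring

/-- If `ρ̂_k = O(ε^{-e})` as long as `β_k = O(1/ε)` and the multipliers are bounded, then iALM
reaches an `ε`-KKT point within `Õ(ε^{-(5+e)/2})` APG iterations. -/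
theorem reachesKKT_of_ρhat_le {v : ℝ} (hv : 0 < v) {e : ℝ} (he : e ≤ 1)
    (hρhat : ∀ Y C₁ : ℝ, 0 ≤ Y → 0 < C₁ → ∃ R : ℝ, 0 < R ∧ ∀ ε : ℝ, 0 < ε → ε ≤ 1 →
      ∀ (k : ℕ) (y : Vec l), ‖y‖ ≤ Y → P.β k ≤ C₁ / ε → P.ρhat k y ≤ R * ε ^ (-e)) :
    ∃ (C : ℝ) (p : ℕ), 0 < C ∧ ∀ ε : ℝ, 0 < ε → ε ≤ 1 →
      ∀ init : ℕ → ℕ → Vec n, (∀ k t, init k t ∈ P.X) → P.Regular ε init v →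
        P.ReachesKKTWithin ε init
          (C * ε ^ (-((5 + e) / 2)) * (1 + Real.log (1 / ε)) ^ p) := by
  obtain ⟨Y, M, Δ, hY, hM, hΔ, hrun⟩ := hP.exists_run_bounds hv
  obtain ⟨C₁, C₂, hC₁, hC₂, hcount⟩ := hP.exists_outer_count hM
  obtain ⟨R, hR, hρ⟩ := hρhat Y C₁ hY hC₁
  obtain ⟨C₃, hC₃, hcost⟩ := hP.exists_cost_bound hY hΔ hC₁ hR he
  refine ⟨C₂ * C₃, 2, by positivity, fun ε hε hε1 init hinit hreg => ?_⟩
  obtain ⟨k, hk, hβk, hcnt⟩ := hcount ε hε hε1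
  have hrun' := hrun ε hε hε1 init hinit hreg
  refine ⟨k + 1, by omega, fun j _ => hP.terminates hε hinit j,
    hP.isKKT_state hε hinit k ((hrun' k).2.1.trans hk), ?_⟩
  have hsum : ∀ j ∈ Finset.range (k + 1), (P.cost ε init j : ℝ) ≤
      C₃ * ε ^ (-((5 + e) / 2)) * (1 + Real.log (1 / ε)) := by
    intro j hj
    have hβj : P.β j ≤ C₁ / ε := (hP.β_mono (Finset.mem_range_succ_iff.1 hj)).trans hβk
    obtain ⟨hy, -, hgap⟩ := hrun' j
    exact hcost ε hε hε1 init hinit j hy hβj (hρ ε hε hε1 j _ hy hβj) hgap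
  have hlog1 := one_le_one_add_log hε hε1
  push_cast
  refine (Finset.sum_le_sum hsum).trans ?_
  rw [Finset.sum_const, Finset.card_range, nsmul_eq_mul]
  calc ((k + 1 : ℕ) : ℝ) * (C₃ * ε ^ (-((5 + e) / 2)) * (1 + Real.log (1 / ε)))
      ≤ (C₂ * (1 + Real.log (1 / ε))) *
        (C₃ * ε ^ (-((5 + e) / 2)) * (1 + Real.log (1 / ε))) := by gcongr
    _ = _ := by ring

end Admissible

end Setup

end IALM


theorem mainTheorem1 {n l : ℕ} (P : IALM.Setup n l) (hP : P.Admissible) (v : ℝ) (hv : 0 < v) :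
    (∃ (C : ℝ) (p : ℕ), 0 < C ∧ ∀ ε : ℝ, 0 < ε → ε ≤ 1 →
      ∀ init : ℕ → ℕ → IALM.Vec n, (∀ k t, init k t ∈ P.X) → P.Regular ε init v →
        P.ReachesKKTWithin ε init (C * ε ^ (-3 : ℝ) * (1 + Real.log (1 / ε)) ^ p)) ∧
    ((∃ (A : IALM.Vec n →ₗ[ℝ] IALM.Vec l) (b : IALM.Vec l), ∀ x, P.c x = A x - b) →
      (∀ j, P.ρ j = 0) →
      ∃ (C : ℝ) (p : ℕ), 0 < C ∧ ∀ ε : ℝ, 0 < ε → ε ≤ 1 →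
        ∀ init : ℕ → ℕ → IALM.Vec n, (∀ k t, init k t ∈ P.X) → P.Regular ε init v →
          P.ReachesKKTWithin ε init (C * ε ^ (-(5 / 2) : ℝ) * (1 + Real.log (1 / ε)) ^ p)) := by
  have hρ₀ := hP.ρ₀_nonneg
  have hρc := hP.ρc_nonneg
  have hLb := P.Lbar_nonneg
  constructor
  · have h := hP.reachesKKT_of_ρhat_le hv (e := 1) le_rfl fun Y C₁ hY hC₁ => by
      refine ⟨P.ρ₀ + P.Lbar * Y + C₁ * P.ρc + 1, by positivity, fun ε hε hε1 k y hy hβ => ?_⟩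
      have hinv : 1 ≤ ε⁻¹ := (one_le_inv₀ hε).2 hε1
      have h1 : P.Lbar * ‖y‖ ≤ P.Lbar * Y := by gcongr
      have h2 : P.β k * P.ρc ≤ C₁ / ε * P.ρc := by gcongr
      have h3 : (P.ρ₀ + P.Lbar * Y) * 1 ≤ (P.ρ₀ + P.Lbar * Y) * ε⁻¹ := by gcongr
      rw [Real.rpow_neg_one, IALM.Setup.ρhat]
      rw [div_eq_mul_inv] at h2
      linarith
    rwa [show -((5 + 1) / 2) = (-3 : ℝ) by norm_num] at h
  · intro _ hρ
    -- Without ρ_c, the parameter ρ̂_k depends on k only through the bounded multiplier, so e = 0 is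
    -- admissible.
    have hρc0 : P.ρc = 0 := by simp [IALM.Setup.ρc, hρ]
    have h := hP.reachesKKT_of_ρhat_le hv (e := 0) zero_le_one fun Y C₁ hY hC₁ => by
      refine ⟨P.ρ₀ + P.Lbar * Y + 1, by positivity, fun ε hε hε1 k y hy hβ => ?_⟩
      have h1 : P.Lbar * ‖y‖ ≤ P.Lbar * Y := by gcongr
      rw [neg_zero, Real.rpow_zero, IALM.Setup.ρhat, hρc0]
      linarith
    rwa [show -((5 + 0) / 2) = (-(5 / 2) : ℝ) by norm_num] at h
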